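/- Let $n,Q\in\mathbb N$ with $Q\ge 1$, and let $\mathbf Q_Q(\mathbb R^n)$ be the space of unordered $Q$-tuples $p=\sum_{i=1}^Q[\![p_i]\!]$ of points of $\mathbb R^n$, with the distance $\mathcal G(p,q)=\min_\sigma\big(\sum_i|p_i-q_{\sigma(i)}|^2\big)^{1/2}$, the minimum being over all permutations $\sigma$ of $\{1,\dots,Q\}$. For a unit vector $v$ let $\xi_v(p)\in\mathbb R^Q$ list the numbers $\langle v,p_1\rangle,\dots,\langle v,p_Q\rangle$ in increasing order. For an orthonormal basis $e=(e_1,\dots,e_n)$ of $\mathbb R^n$ put $\boldsymbol\xi_0=\boldsymbol\xi_0^e=(\xi_{e_1},\dots,\xi_{e_n}):\mathbf Q_Q(\mathbb R^n)\to\mathbb R^{nQ}$. For an open set $\Omega\subset\mathbb C=\mathbb R^2$, $z=u+iv$, a function $f:\Omega\to\mathbf Q_Q(\mathbb R^n)$ is in $\mathcal Y_2(\Omega,\mathbf Q_Q(\mathbb R^n))$ if $\boldsymbol\xi\circ f\in W^{1,2}(\Omega)$, where $\boldsymbol\xi=(\xi_{v_1},\dots,\xi_{v_P})$ is given by finitely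 many unit vectors $v_1,\dots,v_P$, the first $n$ of them the standard basis of $\mathbb R^n$, such that $\boldsymbol\xi$ is bi-Lipschitz onto its image (which such $\boldsymbol\xi$ is used is immaterial). Its Dirichlet integral is $Dir(f;\Omega)=\int_\Omega|\nabla(\boldsymbol\xi_0\circ f)|^2$, with $\boldsymbol\xi_0$ taken in the standard basis. Such an $f$ is called weakly stationary-harmonic if $$\lim_{t\to0}\frac{Dir(f^t;\Omega)-Dir(f;\Omega)}t=0\quad\text{and}\quad \lim_{t\to0}\frac{Dir(f\circ X^t;\Omega)-Dir(f;\Omega)}t=0$$ for all $f^t(x)=\sum_i[\![f_i(x)+t\,\psi(x,f_i(x))]\!]$ with $\psi\in C_c^\infty(\Omega\times\mathbb R^n,\mathbb R^n)$ and all $X^t(x)=x+t\,\phi(x)$ with $\phi\in C_c^\infty(\Omega,\mathbb R^2)$. Let $R_0>0$, $\mathbb U_{R_0}=\{z\in\mathbb C:|z|<R_0\}$, and let $f\in\mathcal Y_2(\mathbb U_{R_0},\mathbf Q_Q(\mathbb R^n))$ be weakly stationary-harmonic. Then: (1) For every choice of $\boldsymbol\xi_0$, $F:=\boldsymbol\xi_0\circ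 f\in W^{1,2}(\mathbb U_{R_0},\mathbb R^{nQ})$, and its Hopf differential $\varphi\,dz^2$, $\varphi=|F_u|^2-|F_v|^2-2i\langle F_u,F_v\rangle$, is holomorphic in $\mathbb U_{R_0}$ (that is, $\varphi$ agrees a.e. with a holomorphic function, again denoted by $\varphi$). (2) For every choice of $\boldsymbol\xi_0$ there is a harmonic function $h:\mathbb U_{R_0}\to\mathbb C\cong\mathbb R^2$ with $\partial_zh=-\tfrac14\varphi$ and $\partial_{\bar z}h=1$, such that $G:=(\boldsymbol\xi_0\circ f,h)\in W^{1,2}_{loc}(\mathbb U_{R_0},\mathbb R^{nQ}\times\mathbb R^2)$ is weakly conformal: $|G_u|=|G_v|$ and $\langle G_u,G_v\rangle=0$ a.e. in $\mathbb U_{R_0}$. (3) If $\varphi,\tilde\varphi$ are the holomorphic functions of (1) for two choices $\boldsymbol\xi_0,\tilde{\boldsymbol\xi}_0$, then in $\mathbb U_{R_0}$ $$|\varphi-\tilde\varphi|=|\operatorname{Im}\varphi-\operatorname{Im}\tilde\varphi|=C(\boldsymbol\xi_0,\tilde{\boldsymbol\xi}_0),$$ a constant depending only on $\boldsymbol\xi_0$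 and $\tilde{\boldsymbol\xi}_0$, and $$C(\boldsymbol\xi_0,\tilde{\boldsymbol\xi}_0)\le\frac4{\pi R_0^2}\,Dir(f;\mathbb U_{R_0}).$$ -/

import Mathlib

open MeasureTheory Metric Filter Topology
open scoped ContDiff

namespace QVal

/-! ### Unordered `Q`-tuples of points and the correspondences built from sorted projections -/

/-- `ℝⁿ` with its Euclidean norm. -/
abbrev Eucl (n : ℕ) : Type := EuclideanSpace ℝ (Fin n)

/-- The space of unordered `Q`-tuples `∑ [[pᵢ]]` of points of `ℝⁿ`
(multisets of cardinality `Q`). -/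
abbrev QSpace (n Q : ℕ) : Type := Sym (Eucl n) Q

/-- `a` enumerates `p`, that is, `p = ∑ᵢ [[a i]]`. -/
def Enumerates {n Q : ℕ} (a : Fin Q → Eucl n) (p : QSpace n Q) : Prop :=
  Multiset.map a Finset.univ.val = (p : Multiset (Eucl n))

/-- The distance `𝒢(p, q) = inf_σ (∑ᵢ |pᵢ - q_{σ(i)}|²)^{1/2}`.  Two enumerations of the same member
differ by a permutation, so that the infimum over `σ` is the infimum over all enumerations. -/
noncomputable def gDist {n Q : ℕ} (p q : QSpace n Q) : ℝ :=
  sInf {d : ℝ | ∃ a b : Fin Q → Eucl n, Enumerates a p ∧ Enumerates b q ∧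
    d = Real.sqrt (∑ i, ‖a i - b i‖ ^ 2)}

/-- The scalar projections `⟨v, pᵢ⟩` of the points of `p`, listed in increasing order. -/
noncomputable def sortedProj {n Q : ℕ} (v : Eucl n) (p : QSpace n Q) : Fin Q → ℝ := fun i =>
  (Multiset.sort ((p : Multiset (Eucl n)).map (fun y => inner ℝ v y))).get
    (i.cast (by rw [Multiset.length_sort, Multiset.card_map]; exact p.2.symm))

/-- The map `p ↦ (ξ(Π_α, p))_α`, where `Π_α` is the orthogonal projection to the line spanned by the
unit vector `v α`. -/
noncomputable def xi {n Q : ℕ} {ι : Type} [Fintype ι] (v : ι → Eucl n) (p : QSpace n Q) :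
    EuclideanSpace ℝ (ι × Fin Q) :=
  WithLp.toLp 2 fun k => sortedProj (v k.1) p k.2

/-- Orthonormal coordinate systems of `ℝⁿ`. -/
abbrev Frame (n : ℕ) : Type := OrthonormalBasis (Fin n) ℝ (Eucl n)

/-- The standard coordinates of `ℝⁿ`. -/
noncomputable def stdFrame (n : ℕ) : Frame n := EuclideanSpace.basisFun (Fin n) ℝ

/-- The Lipschitz correspondence `ξ₀ : QSpace n Q → ℝ^{nQ}` of the orthonormal coordinates `e`. -/
noncomputable def xi0 {n Q : ℕ} (e : Frame n) (p : QSpace n Q) :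
    EuclideanSpace ℝ (Fin n × Fin Q) :=
  xi (fun α => e α) p

/-- The coordinate axes of `ℝⁿ` together with finitely many further directions. -/
noncomputable def directions {n m : ℕ} (w : Fin m → Eucl n) : Fin n ⊕ Fin m → Eucl n :=
  Sum.elim (fun α => stdFrame n α) w

/-- `ξ = ξ(Π_1, ·) ⋈ ⋯ ⋈ ξ(Π_P, ·)`, where the first `n` lines are the coordinate axes and the others
are spanned by the unit vectors `w`, is bi-Lipschitz onto its image. -/
def IsAlmgrenCorrespondence {n m : ℕ} (Q : ℕ) (w : Fin m → Eucl n) : Prop :=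
  (∀ j, ‖w j‖ = 1) ∧
  ∃ c C : ℝ, 0 < c ∧ 0 < C ∧ ∀ p q : QSpace n Q,
    c * gDist p q ≤ ‖xi (directions w) p - xi (directions w) q‖ ∧
    ‖xi (directions w) p - xi (directions w) q‖ ≤ C * gDist p q

/-! ### Weak derivatives and Sobolev functions on open subsets of the plane `ℂ = ℝ²` -/

section Sobolev

variable {V : Type*} [NormedAddCommGroup V] [NormedSpace ℝ V]

/-- `G` is the weak derivative of `F` on the open set `Ω` in the direction `v`
(`v = 1` for `∂/∂u` and `v = Complex.I` for `∂/∂v`, where `z = u + i v`). -/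
def HasWeakPartial (Ω : Set ℂ) (v : ℂ) (F G : ℂ → V) : Prop :=
  LocallyIntegrableOn F Ω ∧ LocallyIntegrableOn G Ω ∧
  ∀ η : ℂ → ℝ, ContDiff ℝ ∞ η → HasCompactSupport η → tsupport η ⊆ Ω →
    ∫ z in Ω, (fderiv ℝ η z v) • F z = - ∫ z in Ω, η z • G z

open Classical in
/-- The weak derivative of `F` on `Ω` in the direction `v` (determined a.e. on `Ω`), and `0` if there
is none. -/
noncomputable def weakPartial (Ω : Set ℂ) (v : ℂ) (F : ℂ → V) : ℂ → V :=
  if h : ∃ G, HasWeakPartial Ω v F G then h.choose else 0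

/-- `F ∈ W^{1,2}(Ω, V)`. -/
def MemW12 (Ω : Set ℂ) (F : ℂ → V) : Prop :=
  MemLp F 2 (volume.restrict Ω) ∧
  ∀ v : ℂ, v = 1 ∨ v = Complex.I →
    ∃ G, HasWeakPartial Ω v F G ∧ MemLp G 2 (volume.restrict Ω)

/-- `F ∈ W^{1,2}_loc(Ω, V)`. -/
def MemW12Loc (Ω : Set ℂ) (F : ℂ → V) : Prop :=
  ∀ U : Set ℂ, IsOpen U → IsCompact (closure U) → closure U ⊆ Ω → MemW12 U F

end Sobolev

section Conformal

variable {V : Type*} [NormedAddCommGroup V] [InnerProductSpace ℝ V]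

/-- The coefficient `(|F_u|² - |F_v|²) - 2 i ⟨F_u, F_v⟩` of `dz²` in the Hopf differential. -/
noncomputable def hopf (Ω : Set ℂ) (F : ℂ → V) (z : ℂ) : ℂ :=
  ((‖weakPartial Ω 1 F z‖ ^ 2 - ‖weakPartial Ω Complex.I F z‖ ^ 2 : ℝ) : ℂ)
    - 2 * Complex.I * ((inner ℝ (weakPartial Ω 1 F z) (weakPartial Ω Complex.I F z) : ℝ) : ℂ)

/-- `|F_u| = |F_v|` and `⟨F_u, F_v⟩ = 0` a.e. in `Ω`. -/
def WeaklyConformal (Ω : Set ℂ) (F : ℂ → V) : Prop :=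
  ∀ᵐ z ∂(volume.restrict Ω),
    ‖weakPartial Ω 1 F z‖ = ‖weakPartial Ω Complex.I F z‖ ∧
    inner ℝ (weakPartial Ω 1 F z) (weakPartial Ω Complex.I F z) = 0

end Conformal

/-- `∂h/∂z = (h_u - i h_v) / 2`. -/
noncomputable def dz (h : ℂ → ℂ) (z : ℂ) : ℂ :=
  (fderiv ℝ h z 1 - Complex.I * fderiv ℝ h z Complex.I) / 2

/-- `∂h/∂z̄ = (h_u + i h_v) / 2`. -/
noncomputable def dzbar (h : ℂ → ℂ) (z : ℂ) : ℂ :=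
  (fderiv ℝ h z 1 + Complex.I * fderiv ℝ h z Complex.I) / 2

/-! ### Multiple-valued Sobolev functions, the Dirichlet integral and its critical points -/

/-- The space `𝒴₂(Ω, QSpace n Q)`: `ξ ∘ f ∈ W^{1,2}` for a bi-Lipschitz correspondence `ξ`
(the condition does not depend on which one is used). -/
def MemY2 {n Q : ℕ} (Ω : Set ℂ) (f : ℂ → QSpace n Q) : Prop :=
  ∃ (m : ℕ) (w : Fin m → Eucl n), IsAlmgrenCorrespondence Q w ∧
    MemW12 Ω (fun z => xi (directions w) (f z))

/-- The Dirichlet integral `Dir(f; Ω) = ∫_Ω |D(ξ₀ ∘ f)|²`, with `ξ₀` taken in the standard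
coordinates of `ℝⁿ`. -/
noncomputable def Dir {n Q : ℕ} (Ω : Set ℂ) (f : ℂ → QSpace n Q) : ℝ :=
  ∫ z in Ω, (‖weakPartial Ω 1 (fun x => xi0 (stdFrame n) (f x)) z‖ ^ 2
    + ‖weakPartial Ω Complex.I (fun x => xi0 (stdFrame n) (f x)) z‖ ^ 2)

/-- The range-variation `fᵗ(x) = ∑ᵢ [[fᵢ(x) + t ψ(x, fᵢ(x))]]`. -/
noncomputable def rangeVariation {n Q : ℕ} (f : ℂ → QSpace n Q) (ψ : ℂ × Eucl n → Eucl n) (t : ℝ) :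
    ℂ → QSpace n Q :=
  fun x => (f x).map fun y => y + t • ψ (x, y)

/-- Weakly harmonic: critical for the Dirichlet integral under the range-variations given by
`ψ ∈ C_c^∞(Ω × ℝⁿ, ℝⁿ)`. -/
def WeaklyHarmonic {n Q : ℕ} (Ω : Set ℂ) (f : ℂ → QSpace n Q) : Prop :=
  ∀ ψ : ℂ × Eucl n → Eucl n, ContDiff ℝ ∞ ψ → HasCompactSupport ψ →
    tsupport ψ ⊆ Ω ×ˢ Set.univ →
    Tendsto (fun t : ℝ => (Dir Ω (rangeVariation f ψ t) - Dir Ω f) / t) (𝓝[≠] 0) (𝓝 0)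

/-- Weakly Noether harmonic: critical for the Dirichlet integral under the domain-variations
`x ↦ x + t φ(x)` with `φ ∈ C_c^∞(Ω, ℝ²)`, which are diffeomorphisms of `Ω` for small `|t|`. -/
def WeaklyNoetherHarmonic {n Q : ℕ} (Ω : Set ℂ) (f : ℂ → QSpace n Q) : Prop :=
  ∀ φ : ℂ → ℂ, ContDiff ℝ ∞ φ → HasCompactSupport φ → tsupport φ ⊆ Ω →
    Tendsto (fun t : ℝ => (Dir Ω (fun x => f (x + t • φ x)) - Dir Ω f) / t) (𝓝[≠] 0) (𝓝 0)

/-- Weakly stationary-harmonic functions of the class `𝒴₂`. -/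
def WeaklyStationaryHarmonic {n Q : ℕ} (Ω : Set ℂ) (f : ℂ → QSpace n Q) : Prop :=
  MemY2 Ω f ∧ WeaklyHarmonic Ω f ∧ WeaklyNoetherHarmonic Ω f

end QVal

/-! The constant in the comparison of two frames can be taken to be `0`, because the Hopf
differential does not depend on the frame at all. The reason is that each correspondence is an
isometry to first order. If `q` is close to `p`, with enumerations `b` and `a` close entry by entry,
then sorting by a projection of `b` also sorts the projection of `a`. The increment of the sorted
projections is therefore the projected increment, and Parseval gives `‖xi0 e p - xi0 e q‖² = ∑ ‖a i
- b i‖²`, in which `e` no longer occurs (`exists_norm_xi0_sub_eq`). Difference quotients of Sobolev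
functions converge almost everywhere along a subsequence, so this equality of increments becomes an
equality of lengths of weak derivatives (`ae_norm_eq_of_norm_sub_eq`). Applied in the directions
`1`, `I` and `1 + I`, it gives by polarisation the same Hopf differential in all frames
(`MemY2.hopf_ae_eq`).

Membership in `W^{1,2}` for every frame holds because `xi0 e` is 1-Lipschitz for `gDist`, which is
controlled by the bi-Lipschitz correspondence, and increment bounds preserve the Sobolev class
(`memW12_of_norm_sub_le`).

For holomorphy, the energy of a domain variation `z + t η(z) a` is rewritten by a change of
variables so that `t` enters only through smooth coefficients. Differentiating at `t = 0` for `a =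
1` and `a = I` and combining the two equations gives the distributional Cauchy–Riemann equation for
the Hopf differential (`integral_hopf_eq_zero`). Weyl's lemma then supplies a holomorphic
representative `φ` (`exists_differentiableOn_ae_eq`).

Finally `h = H + z̄` with `H' = -φ/4` has Hopf differential `4 h_z · conj(h_z̄) = -φ`, which cancels
that of `xi0 e ∘ f`. A map is weakly conformal exactly when its Hopf differential vanishes. -/

namespace QVal

/-! ### Sorted projections and the local isometry of the correspondences -/

section Sorting
variable {n Q : ℕ}

theorem exists_enumerates (p : QSpace n Q) : ∃ a : Fin Q → Eucl n, Enumerates a p := by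
  obtain ⟨s, hs⟩ := p
  induction s using Quotient.inductionOn with
  | h l =>
    have hl : l.length = Q := hs
    subst hl
    refine ⟨l.get, ?_⟩
    simp [Enumerates, Fin.univ_val_map]

theorem Enumerates.comp_perm {a : Fin Q → Eucl n} {p : QSpace n Q} (h : Enumerates a p)
    (σ : Equiv.Perm (Fin Q)) : Enumerates (a ∘ σ) p := by
  unfold Enumerates at *
  rw [← h, ← Multiset.map_map]
  congr 1
  simp

theorem Enumerates.mem_range_iff {a : Fin Q → Eucl n} {p : QSpace n Q} (h : Enumerates a p)
    (y : Eucl n) : y ∈ (p : Multiset (Eucl n)) ↔ ∃ i, a i = y := by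
  rw [← h]; simp

/-- Two sorted lists that are permutations of each other coincide. -/
theorem sortedProj_eq_of_monotone {a : Fin Q → Eucl n} {p : QSpace n Q} (h : Enumerates a p)
    {v : Eucl n} (hm : Monotone fun i => inner ℝ v (a i)) :
    sortedProj v p = fun i => inner ℝ v (a i) := by
  have key : Multiset.sort ((p : Multiset (Eucl n)).map (fun y => (inner ℝ v y : ℝ)))
      = List.ofFn fun i => (inner ℝ v (a i) : ℝ) := by
    apply List.Perm.eq_of_pairwise' (r := (· ≤ ·))
    · exact Multiset.pairwise_sort _ _
    · exact hm.sortedLE_ofFn.pairwise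
    · rw [← Multiset.coe_eq_coe, Multiset.sort_eq, ← h, Multiset.map_map, Fin.univ_val_map]
      rfl
  funext i
  simp only [sortedProj, List.get_eq_getElem, key]
  simp

/-- Some permutation sorts the projections of an enumeration. -/
theorem sortedProj_eq_comp_sort {a : Fin Q → Eucl n} {p : QSpace n Q} (h : Enumerates a p)
    (v : Eucl n) :
    sortedProj v p = fun i => inner ℝ v (a (Tuple.sort (fun i => (inner ℝ v (a i) : ℝ)) i)) :=
  sortedProj_eq_of_monotone (h.comp_perm _) (Tuple.monotone_sort fun i => (inner ℝ v (a i) : ℝ))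

/-- The rearrangement inequality: permuting does not change the sums of squares, and the cross term
is largest when both families are sorted. -/
theorem sum_sq_sub_le_of_monotone {x y : Fin Q → ℝ} {σ τ : Equiv.Perm (Fin Q)}
    (hx : Monotone (x ∘ σ)) (hy : Monotone (y ∘ τ)) :
    ∑ i, (x (σ i) - y (τ i)) ^ 2 ≤ ∑ i, (x i - y i) ^ 2 := by
  have hmv : Monovary (x ∘ σ) (y ∘ τ) := hx.monovary hy
  -- This permutation undoes the two sortings and restores the original pairing of `x i` with `y i`.
  have h1 := hmv.sum_comp_perm_mul_le_sum_mul (σ := τ.trans σ.symm)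
  have h2 : ∑ i, (x ∘ σ) ((τ.trans σ.symm) i) * (y ∘ τ) i = ∑ i, x i * y i := by
    rw [← Equiv.sum_comp τ (fun i => x i * y i)]
    simp
  have h3 : ∑ i, (x (σ i)) ^ 2 = ∑ i, x i ^ 2 := Equiv.sum_comp σ fun i => x i ^ 2
  have h4 : ∑ i, (y (τ i)) ^ 2 = ∑ i, y i ^ 2 := Equiv.sum_comp τ fun i => y i ^ 2
  have h5 : ∀ u w : Fin Q → ℝ, ∑ i, (u i - w i) ^ 2
      = ∑ i, u i ^ 2 - 2 * ∑ i, u i * w i + ∑ i, w i ^ 2 := by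
    intro u w
    rw [Finset.mul_sum, ← Finset.sum_sub_distrib, ← Finset.sum_add_distrib]
    exact Finset.sum_congr rfl fun i _ => by ring
  rw [h5 (fun i => x (σ i)) (fun i => y (τ i)), h5, h3, h4]
  simp only [Function.comp_apply] at h1 h2
  rw [h2] at h1
  linarith

theorem sum_sq_sortedProj_sub_le {a b : Fin Q → Eucl n} {p q : QSpace n Q} (ha : Enumerates a p)
    (hb : Enumerates b q) (v : Eucl n) :
    ∑ i, (sortedProj v p i - sortedProj v q i) ^ 2 ≤ ∑ i, (inner ℝ v (a i - b i) : ℝ) ^ 2 := by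
  rw [sortedProj_eq_comp_sort ha, sortedProj_eq_comp_sort hb]
  simp only [inner_sub_right]
  exact sum_sq_sub_le_of_monotone (x := fun i => inner ℝ v (a i)) (y := fun i => inner ℝ v (b i))
    (Tuple.monotone_sort _) (Tuple.monotone_sort _)

theorem norm_sq_xi0_sub (e : Frame n) (p q : QSpace n Q) :
    ‖xi0 e p - xi0 e q‖ ^ 2
      = ∑ α, ∑ i, (sortedProj (e α) p i - sortedProj (e α) q i) ^ 2 := by
  rw [EuclideanSpace.norm_sq_eq, Fintype.sum_prod_type]
  simp [xi0, xi]

/-- Parseval, point by point. The frame disappears from the right-hand side, which is the source of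
all frame independence below. -/
theorem sum_sum_inner_sq (e : Frame n) (c : Fin Q → Eucl n) :
    ∑ α, ∑ i, (inner ℝ (e α) (c i) : ℝ) ^ 2 = ∑ i, ‖c i‖ ^ 2 := by
  rw [Finset.sum_comm]
  refine Finset.sum_congr rfl fun i _ => ?_
  have := e.sum_sq_norm_inner_right (c i)
  simpa using this

theorem norm_xi0_sub_le_of_enumerates (e : Frame n) {a b : Fin Q → Eucl n} {p q : QSpace n Q}
    (ha : Enumerates a p) (hb : Enumerates b q) :
    ‖xi0 e p - xi0 e q‖ ≤ Real.sqrt (∑ i, ‖a i - b i‖ ^ 2) := by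
  apply Real.le_sqrt_of_sq_le
  rw [norm_sq_xi0_sub, ← sum_sum_inner_sq e]
  exact Finset.sum_le_sum fun α _ => sum_sq_sortedProj_sub_le ha hb _

theorem gDist_set_nonempty (p q : QSpace n Q) :
    {d : ℝ | ∃ a b : Fin Q → Eucl n, Enumerates a p ∧ Enumerates b q ∧
      d = Real.sqrt (∑ i, ‖a i - b i‖ ^ 2)}.Nonempty := by
  obtain ⟨a, ha⟩ := exists_enumerates p
  obtain ⟨b, hb⟩ := exists_enumerates q
  exact ⟨_, a, b, ha, hb, rfl⟩

/-- The correspondence of an orthonormal frame does not increase distances. -/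
theorem norm_xi0_sub_le_gDist (e : Frame n) (p q : QSpace n Q) :
    ‖xi0 e p - xi0 e q‖ ≤ gDist p q := by
  apply le_csInf (gDist_set_nonempty p q)
  rintro d ⟨a, b, ha, hb, rfl⟩
  exact norm_xi0_sub_le_of_enumerates e ha hb

/-- Members close to `p` can be listed in the order of the projections of `p`. -/
theorem exists_sum_sq_sortedProj_sub_eq (p : QSpace n Q) {v : Eucl n} (hv : ‖v‖ = 1) :
    ∃ δ > 0, ∀ (q : QSpace n Q) (a b : Fin Q → Eucl n), Enumerates a p → Enumerates b q →
      (∀ i, ‖a i - b i‖ < δ) →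
      ∑ i, (sortedProj v p i - sortedProj v q i) ^ 2 = ∑ i, (inner ℝ v (a i - b i) : ℝ) ^ 2 := by
  obtain ⟨a₀, h₀⟩ := exists_enumerates p
  -- Half the smallest gap between distinct projected values of `p`. It is chosen from one fixed
  -- enumeration but depends only on the set of values, hence serves every enumeration `a` of `p`.
  obtain ⟨δ, hδ, hgap⟩ : ∃ δ > 0, ∀ i j, (inner ℝ v (a₀ i) : ℝ) < inner ℝ v (a₀ j) →
      2 * δ ≤ inner ℝ v (a₀ j) - inner ℝ v (a₀ i) := by
    have : ∀ᶠ δ : ℝ in 𝓝[>] 0, ∀ i j, (inner ℝ v (a₀ i) : ℝ) < inner ℝ v (a₀ j) →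
        2 * δ ≤ inner ℝ v (a₀ j) - inner ℝ v (a₀ i) := by
      rw [eventually_all]
      intro i
      rw [eventually_all]
      intro j
      by_cases h : (inner ℝ v (a₀ i) : ℝ) < inner ℝ v (a₀ j)
      · have : Tendsto (fun δ : ℝ => 2 * δ) (𝓝[>] 0) (𝓝 0) := by
          have : Tendsto (fun δ : ℝ => 2 * δ) (𝓝 0) (𝓝 (2 * 0)) := tendsto_id.const_mul 2
          rw [mul_zero] at this
          exact this.mono_left nhdsWithin_le_nhds
        filter_upwards [this.eventually (gt_mem_nhds (sub_pos.2 h))] with δ hδ _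
        exact hδ.le
      · exact Eventually.of_forall fun δ h' => absurd h' h
    obtain ⟨δ, h1, h2⟩ := (this.and self_mem_nhdsWithin).exists
    exact ⟨δ, h2, h1⟩
  refine ⟨δ, hδ, fun q a b ha hb hab => ?_⟩
  have hgap' : ∀ i j, (inner ℝ v (a i) : ℝ) < inner ℝ v (a j) →
      2 * δ ≤ inner ℝ v (a j) - inner ℝ v (a i) := by
    intro i j h
    obtain ⟨i', hi⟩ := (h₀.mem_range_iff _).1 ((ha.mem_range_iff _).2 ⟨i, rfl⟩)
    obtain ⟨j', hj⟩ := (h₀.mem_range_iff _).1 ((ha.mem_range_iff _).2 ⟨j, rfl⟩)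
    rw [← hi, ← hj] at h ⊢
    exact hgap _ _ h
  have hclose : ∀ i, |(inner ℝ v (a i) : ℝ) - inner ℝ v (b i)| < δ := by
    intro i
    rw [← inner_sub_right]
    refine (abs_real_inner_le_norm _ _).trans_lt ?_
    rw [hv, one_mul]
    exact hab i
  set τ := Tuple.sort (fun i => (inner ℝ v (b i) : ℝ))
  have hτ : Monotone fun i => (inner ℝ v ((b ∘ τ) i) : ℝ) :=
    Tuple.monotone_sort (fun i => (inner ℝ v (b i) : ℝ))
  -- Each projection moves by less than `δ` and distinct values of `a` are at least `2 * δ` apart,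
  -- so no strict inequality can be reversed. Ties in `a` do no harm: `τ` may order them in any way.
  have hτ' : Monotone fun i => (inner ℝ v ((a ∘ τ) i) : ℝ) := by
    intro i j hij
    by_contra! hlt
    have h1 := hgap' _ _ hlt
    have h2 := hτ hij
    have h3 := abs_lt.1 (hclose (τ i))
    have h4 := abs_lt.1 (hclose (τ j))
    simp only [Function.comp_apply] at h1 h2
    linarith
  rw [sortedProj_eq_of_monotone (ha.comp_perm τ) hτ', sortedProj_eq_of_monotone (hb.comp_perm τ) hτ,
    ← Equiv.sum_comp τ fun i => (inner ℝ v (a i - b i) : ℝ) ^ 2]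
  simp [inner_sub_right]

/-- Every `ξ₀` is, near a given member, isometric with respect to suitable enumerations; hence two
of them have the same increments there. -/
theorem exists_norm_xi0_sub_eq (p : QSpace n Q) (e e' : Frame n) :
    ∃ δ > 0, ∀ q, gDist p q < δ → ‖xi0 e p - xi0 e q‖ = ‖xi0 e' p - xi0 e' q‖ := by
  have hex : ∀ e : Frame n, ∃ δ > 0, ∀ (q : QSpace n Q) (a b : Fin Q → Eucl n), Enumerates a p →
      Enumerates b q → (∀ i, ‖a i - b i‖ < δ) →
      ‖xi0 e p - xi0 e q‖ ^ 2 = ∑ i, ‖a i - b i‖ ^ 2 := by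
    intro e
    choose δ hδ h using fun α => exists_sum_sq_sortedProj_sub_eq p (e.norm_eq_one α)
    obtain ⟨d, hd, hd'⟩ : ∃ d > 0, ∀ α, d ≤ δ α := by
      have : ∀ᶠ d : ℝ in 𝓝[>] 0, ∀ α, d ≤ δ α := by
        rw [eventually_all]
        intro α
        filter_upwards [nhdsWithin_le_nhds (gt_mem_nhds (hδ α))] with d hd
        exact hd.le
      obtain ⟨δ, h1, h2⟩ := (this.and self_mem_nhdsWithin).exists
      exact ⟨δ, h2, h1⟩
    refine ⟨d, hd, fun q a b ha hb hab => ?_⟩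
    rw [norm_sq_xi0_sub, ← sum_sum_inner_sq e]
    exact Finset.sum_congr rfl fun α _ => h α q a b ha hb fun i => (hab i).trans_le (hd' α)
  obtain ⟨δ, hδ, h⟩ := hex e
  obtain ⟨δ', hδ', h'⟩ := hex e'
  refine ⟨min δ δ', lt_min hδ hδ', fun q hq => ?_⟩
  -- One nearly optimal pair of enumerations serves both frames, so both increments equal the same
  -- sum.
  obtain ⟨_, ⟨a, b, ha, hb, rfl⟩, hd⟩ := exists_lt_of_csInf_lt (gDist_set_nonempty p q) hq
  have hi : ∀ i, ‖a i - b i‖ < min δ δ' := by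
    intro i
    refine lt_of_le_of_lt ?_ hd
    apply Real.le_sqrt_of_sq_le
    exact Finset.single_le_sum (f := fun i => ‖a i - b i‖ ^ 2) (fun _ _ => sq_nonneg _)
      (Finset.mem_univ i)
  rw [← sq_eq_sq₀ (norm_nonneg _) (norm_nonneg _),
    h q a b ha hb fun i => (hi i).trans_le (min_le_left _ _),
    h' q a b ha hb fun i => (hi i).trans_le (min_le_right _ _)]

end Sorting
end QVal

namespace QVal

/-! ### Calculus of weak directional derivatives -/

section WeakPartial
variable {V W : Type*} [NormedAddCommGroup V] [NormedSpace ℝ V] [NormedAddCommGroup W]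
  [NormedSpace ℝ W] {Ω U : Set ℂ} {v w : ℂ} {F F' G G' : ℂ → V}

theorem integrable_smul_of_locallyIntegrableOn {g : ℂ → ℝ} (hg : Continuous g)
    (hc : HasCompactSupport g) (hs : tsupport g ⊆ Ω) (hF : LocallyIntegrableOn F Ω) :
    Integrable fun z => g z • F z := by
  have h1 : IntegrableOn F (tsupport g) := hF.integrableOn_compact_subset hs hc
  have h2 : IntegrableOn (fun z => g z • F z) (tsupport g) :=
    h1.continuousOn_smul hg.continuousOn hc
  refine (integrableOn_iff_integrable_of_support_subset ?_).1 h2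
  intro z hz
  refine subset_tsupport g fun h => hz ?_
  change g z • F z = 0
  rw [h, zero_smul]

theorem setIntegral_smul_eq_integral {g : ℂ → ℝ} (hs : tsupport g ⊆ Ω) :
    ∫ z in Ω, g z • F z = ∫ z, g z • F z := by
  refine setIntegral_eq_integral_of_forall_compl_eq_zero fun z hz => ?_
  rw [image_eq_zero_of_notMem_tsupport fun h => hz (hs h), zero_smul]

theorem continuous_fderiv_apply {η : ℂ → ℝ} (h : ContDiff ℝ ∞ η) (v : ℂ) :
    Continuous fun z => fderiv ℝ η z v :=
  (h.continuous_fderiv (by simp)).clm_apply continuous_const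

theorem tsupport_fderiv_apply (η : ℂ → ℝ) (v : ℂ) :
    tsupport (fun z => fderiv ℝ η z v) ⊆ tsupport η := tsupport_fderiv_apply_subset ℝ v

theorem hasCompactSupport_fderiv_apply {η : ℂ → ℝ} (h : HasCompactSupport η) (v : ℂ) :
    HasCompactSupport fun z => fderiv ℝ η z v :=
  h.fderiv_apply ℝ v

theorem HasWeakPartial.integral_eq (h : HasWeakPartial Ω v F G) {η : ℂ → ℝ} (h1 : ContDiff ℝ ∞ η)
    (h2 : HasCompactSupport η) (h3 : tsupport η ⊆ Ω) :
    ∫ z, (fderiv ℝ η z v) • F z = - ∫ z, η z • G z := by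
  have := h.2.2 η h1 h2 h3
  rwa [setIntegral_smul_eq_integral ((tsupport_fderiv_apply η v).trans h3),
    setIntegral_smul_eq_integral h3] at this

theorem hasWeakPartial_of_integral (hF : LocallyIntegrableOn F Ω) (hG : LocallyIntegrableOn G Ω)
    (h : ∀ η : ℂ → ℝ, ContDiff ℝ ∞ η → HasCompactSupport η → tsupport η ⊆ Ω →
      ∫ z, (fderiv ℝ η z v) • F z = - ∫ z, η z • G z) : HasWeakPartial Ω v F G := by
  refine ⟨hF, hG, fun η h1 h2 h3 => ?_⟩
  rw [setIntegral_smul_eq_integral ((tsupport_fderiv_apply η v).trans h3),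
    setIntegral_smul_eq_integral h3]
  exact h η h1 h2 h3

theorem HasWeakPartial.integrable_left (h : HasWeakPartial Ω v F G) {η : ℂ → ℝ}
    (h1 : ContDiff ℝ ∞ η) (h2 : HasCompactSupport η) (h3 : tsupport η ⊆ Ω) (w : ℂ) :
    Integrable fun z => (fderiv ℝ η z w) • F z :=
  integrable_smul_of_locallyIntegrableOn (continuous_fderiv_apply h1 w)
    (hasCompactSupport_fderiv_apply h2 w) ((tsupport_fderiv_apply η w).trans h3) h.1

theorem HasWeakPartial.integrable_right (h : HasWeakPartial Ω v F G) {η : ℂ → ℝ}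
    (h1 : ContDiff ℝ ∞ η) (h2 : HasCompactSupport η) (h3 : tsupport η ⊆ Ω) :
    Integrable fun z => η z • G z :=
  integrable_smul_of_locallyIntegrableOn h1.continuous h2 h3 h.2.1

/-- The fundamental lemma of the calculus of variations. It makes the chosen `weakPartial`
interchangeable with any explicit weak derivative. -/
theorem HasWeakPartial.ae_eq [CompleteSpace V] (hΩ : IsOpen Ω) (h : HasWeakPartial Ω v F G)
    (h' : HasWeakPartial Ω v F G') : G =ᵐ[volume.restrict Ω] G' := by
  have := hΩ.ae_eq_zero_of_integral_contDiff_smul_eq_zero (μ := volume) (h.2.1.sub h'.2.1)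
    (fun η h1 h2 h3 => by
      have e := neg_injective ((h.integral_eq h1 h2 h3).symm.trans (h'.integral_eq h1 h2 h3))
      simp only [Pi.sub_apply, smul_sub]
      rw [integral_sub (h.integrable_right h1 h2 h3) (h'.integrable_right h1 h2 h3), e, sub_self])
  rw [Filter.EventuallyEq, ae_restrict_iff' hΩ.measurableSet]
  filter_upwards [this] with z hz hzΩ
  exact sub_eq_zero.1 (hz hzΩ)

theorem HasWeakPartial.weakPartial (h : HasWeakPartial Ω v F G) :
    HasWeakPartial Ω v F (weakPartial Ω v F) := by
  have h' : ∃ G, HasWeakPartial Ω v F G := ⟨G, h⟩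
  rw [QVal.weakPartial, dif_pos h']
  exact h'.choose_spec

theorem HasWeakPartial.weakPartial_ae_eq [CompleteSpace V] (hΩ : IsOpen Ω)
    (h : HasWeakPartial Ω v F G) : QVal.weakPartial Ω v F =ᵐ[volume.restrict Ω] G :=
  h.weakPartial.ae_eq hΩ h

/-- Provides the derivative in the direction `1 + I`, from which polarisation recovers the inner
product of the two partial derivatives. -/
theorem HasWeakPartial.add_dir (h : HasWeakPartial Ω v F G) (h' : HasWeakPartial Ω w F G') :
    HasWeakPartial Ω (v + w) F (fun z => G z + G' z) := by
  refine hasWeakPartial_of_integral h.1 (h.2.1.add h'.2.1) fun η h1 h2 h3 => ?_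
  simp only [map_add, add_smul, smul_add]
  rw [integral_add (h.integrable_left h1 h2 h3 v) (h.integrable_left h1 h2 h3 w),
    integral_add (h.integrable_right h1 h2 h3) (h'.integrable_right h1 h2 h3),
    h.integral_eq h1 h2 h3, h'.integral_eq h1 h2 h3, neg_add]

theorem HasWeakPartial.mono (h : HasWeakPartial Ω v F G) (hU : U ⊆ Ω) :
    HasWeakPartial U v F G :=
  hasWeakPartial_of_integral (h.1.mono_set hU) (h.2.1.mono_set hU) fun _ h1 h2 h3 =>
    h.integral_eq h1 h2 (h3.trans hU)

theorem HasWeakPartial.clm_comp [CompleteSpace V] [CompleteSpace W] (h : HasWeakPartial Ω v F G)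
    (L : V →L[ℝ] W) : HasWeakPartial Ω v (fun z => L (F z)) (fun z => L (G z)) := by
  have hL : ∀ {H : ℂ → V}, LocallyIntegrableOn H Ω → LocallyIntegrableOn (fun z => L (H z)) Ω := by
    intro H hH x hx
    obtain ⟨s, hs, hi⟩ := hH x hx
    exact ⟨s, hs, L.integrable_comp hi⟩
  refine hasWeakPartial_of_integral (hL h.1) (hL h.2.1) fun η h1 h2 h3 => ?_
  simp only [← map_smul]
  rw [L.integral_comp_comm (h.integrable_left h1 h2 h3 v),
    L.integral_comp_comm (h.integrable_right h1 h2 h3), h.integral_eq h1 h2 h3, map_neg]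

theorem HasWeakPartial.add (h : HasWeakPartial Ω v F G) (h' : HasWeakPartial Ω v F' G') :
    HasWeakPartial Ω v (fun z => F z + F' z) (fun z => G z + G' z) := by
  refine hasWeakPartial_of_integral (h.1.add h'.1) (h.2.1.add h'.2.1) fun η h1 h2 h3 => ?_
  simp only [smul_add]
  rw [integral_add (h.integrable_left h1 h2 h3 v) (h'.integrable_left h1 h2 h3 v),
    integral_add (h.integrable_right h1 h2 h3) (h'.integrable_right h1 h2 h3),
    h.integral_eq h1 h2 h3, h'.integral_eq h1 h2 h3, neg_add]

theorem hasWeakPartial_of_contDiffOn (hΩ : IsOpen Ω) (hF : ContDiffOn ℝ 1 F Ω) (v : ℂ) :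
    HasWeakPartial Ω v F (fun z => fderiv ℝ F z v) := by
  have hF' : ContinuousOn (fun z => fderiv ℝ F z v) Ω :=
    (hF.continuousOn_fderiv_of_isOpen hΩ le_rfl).clm_apply continuousOn_const
  have hi := hF.continuousOn.locallyIntegrableOn (μ := volume) hΩ.measurableSet
  have hi' := hF'.locallyIntegrableOn (μ := volume) hΩ.measurableSet
  refine hasWeakPartial_of_integral hi hi' fun η h1 h2 h3 => ?_
  have := integral_smul_fderiv_eq_neg_fderiv_smul_of_integrable (μ := volume) (f := η) (g := F)
    (v := v)
    (integrable_smul_of_locallyIntegrableOn (continuous_fderiv_apply h1 v)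
      (hasCompactSupport_fderiv_apply h2 v) ((tsupport_fderiv_apply η v).trans h3) hi)
    (integrable_smul_of_locallyIntegrableOn h1.continuous h2 h3 hi')
    (integrable_smul_of_locallyIntegrableOn h1.continuous h2 h3 hi)
    (fun z _ => (h1.differentiable (by simp)).differentiableAt)
    (fun z hz => ((hF.differentiableOn (by simp)).differentiableAt (hΩ.mem_nhds (h3 hz))))
  rw [this, neg_neg]

theorem MemW12.exists_hasWeakPartial (h : MemW12 Ω F) (hv : v = 1 ∨ v = Complex.I) :
    HasWeakPartial Ω v F (weakPartial Ω v F) := by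
  obtain ⟨G, hG, -⟩ := h.2 v hv
  exact hG.weakPartial

theorem MemW12.memLp_weakPartial [CompleteSpace V] (hΩ : IsOpen Ω) (h : MemW12 Ω F)
    (hv : v = 1 ∨ v = Complex.I) : MemLp (weakPartial Ω v F) 2 (volume.restrict Ω) := by
  obtain ⟨G, hG, hG2⟩ := h.2 v hv
  exact (memLp_congr_ae (hG.weakPartial_ae_eq hΩ)).2 hG2

theorem MemW12.mono (h : MemW12 Ω F) (hU : U ⊆ Ω) : MemW12 U F := by
  refine ⟨h.1.mono_measure (Measure.restrict_mono hU le_rfl), fun v hv => ?_⟩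
  obtain ⟨G, hG, hG2⟩ := h.2 v hv
  exact ⟨G, hG.mono hU, hG2.mono_measure (Measure.restrict_mono hU le_rfl)⟩

theorem MemW12.clm_comp [CompleteSpace V] [CompleteSpace W] (h : MemW12 Ω F) (L : V →L[ℝ] W) :
    MemW12 Ω fun z => L (F z) := by
  refine ⟨L.comp_memLp' h.1, fun v hv => ?_⟩
  obtain ⟨G, hG, hG2⟩ := h.2 v hv
  exact ⟨_, hG.clm_comp L, L.comp_memLp' hG2⟩

theorem MemW12.add (h : MemW12 Ω F) (h' : MemW12 Ω F') : MemW12 Ω fun z => F z + F' z := by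
  refine ⟨h.1.add h'.1, fun v hv => ?_⟩
  obtain ⟨G, hG, hG2⟩ := h.2 v hv
  obtain ⟨G', hG', hG2'⟩ := h'.2 v hv
  exact ⟨_, hG.add hG', hG2.add hG2'⟩

end WeakPartial
end QVal

namespace QVal

/-! ### Mollification and convergence of difference quotients in `L¹` -/

section Mollify
open scoped Convolution ENNReal
open ContinuousLinearMap (lsmul lsmul_apply)
variable {V : Type*} [NormedAddCommGroup V] [NormedSpace ℝ V] {Ω K : Set ℂ} {v : ℂ}
  {F G g : ℂ → V}

omit [NormedSpace ℝ V] in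
theorem tendsto_eLpNorm_translate_sub (hg : Integrable g) :
    Tendsto (fun w : ℂ => eLpNorm (fun z => g (z + w) - g z) 1 volume) (𝓝 0) (𝓝 0) := by
  have hmp : ∀ w : ℂ, MeasurePreserving (ContinuousMap.addRight w : C(ℂ, ℂ)) volume volume :=
    fun w => measurePreserving_add_right volume w
  have hm : MemLp g 1 volume := memLp_one_iff_integrable.2 hg
  have hc : Tendsto (fun w : ℂ => Lp.compMeasurePreserving (ContinuousMap.addRight w : C(ℂ, ℂ))
      (hmp w) hm.toLp) (𝓝 0) (𝓝 (Lp.compMeasurePreserving (ContinuousMap.addRight (0 : ℂ) : C(ℂ, ℂ))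
      (hmp 0) hm.toLp)) := by
    refine Filter.Tendsto.compMeasurePreservingLp tendsto_const_nhds ?_ _ _ ENNReal.one_ne_top
    let g2 : C(ℂ × ℂ, ℂ) := ⟨fun p => p.2 + p.1, by fun_prop⟩
    exact g2.curry.continuous.tendsto 0
  rw [tendsto_iff_edist_tendsto_0] at hc
  refine hc.congr fun w => ?_
  rw [Lp.toLp_compMeasurePreserving, Lp.toLp_compMeasurePreserving, Lp.edist_toLp_toLp]
  congr 1
  funext z
  simp

/-- A sequence of smooth kernels whose supports shrink to the origin. -/
noncomputable def kernelBump (k : ℕ) : ContDiffBump (0 : ℂ) where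
  rIn := 1 / (k + 1 : ℝ) / 2
  rOut := 1 / (k + 1 : ℝ)
  rIn_pos := by positivity
  rIn_lt_rOut := half_lt_self (by positivity)

/-- The convolution of `g` with the `k`-th smooth kernel. -/
noncomputable def mollify (k : ℕ) (g : ℂ → V) : ℂ → V :=
  (kernelBump k).normed volume ⋆[lsmul ℝ ℝ, volume] g

theorem contDiff_kernel (k : ℕ) : ContDiff ℝ ∞ ((kernelBump k).normed volume) :=
  (kernelBump k).contDiff_normed

theorem contDiff_mollify (k : ℕ) (hg : LocallyIntegrable g) : ContDiff ℝ ∞ (mollify k g) :=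
  (kernelBump k).hasCompactSupport_normed.contDiff_convolution_left _ (contDiff_kernel k) hg

/-- The kernel centred at `z`, as a test function. -/
noncomputable def kernelAt (k : ℕ) (z w : ℂ) : ℝ := (kernelBump k).normed volume (z - w)

theorem contDiff_kernelAt (k : ℕ) (z : ℂ) : ContDiff ℝ ∞ (kernelAt k z) :=
  (contDiff_kernel k).comp (contDiff_const.sub contDiff_id)

theorem tsupport_kernelAt (k : ℕ) (z : ℂ) :
    tsupport (kernelAt k z) ⊆ closedBall z (1 / (k + 1 : ℝ)) := by
  refine closure_minimal (fun w hw => ?_) isClosed_closedBall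
  have : z - w ∈ Function.support ((kernelBump k).normed volume) := hw
  rw [(kernelBump k).support_normed_eq, mem_ball, dist_zero_right, ← dist_eq_norm, dist_comm] at this
  exact this.le

theorem hasCompactSupport_kernelAt (k : ℕ) (z : ℂ) : HasCompactSupport (kernelAt k z) :=
  HasCompactSupport.of_support_subset_isCompact (isCompact_closedBall z (1 / (k + 1 : ℝ)))
    ((subset_tsupport _).trans (tsupport_kernelAt k z))

theorem mollify_apply (k : ℕ) (g : ℂ → V) (z : ℂ) :
    mollify k g z = ∫ w, kernelAt k z w • g w := by
  rw [mollify, convolution_eq_swap]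
  rfl

theorem fderiv_mollify [CompleteSpace V] (k : ℕ) (hg : LocallyIntegrable g) (z v : ℂ) :
    fderiv ℝ (mollify k g) z v = - ∫ w, fderiv ℝ (kernelAt k z) w v • g w := by
  have h := (kernelBump k).hasCompactSupport_normed.hasFDerivAt_convolution_left (lsmul ℝ ℝ)
    ((contDiff_kernel k).of_le (by simp)) hg z (μ := volume)
  rw [mollify, h.fderiv, convolution_eq_swap, ← integral_neg]
  rw [ContinuousLinearMap.integral_apply]
  · refine integral_congr_ae (Eventually.of_forall fun w => ?_)
    have : fderiv ℝ (kernelAt k z) w v = - fderiv ℝ ((kernelBump k).normed volume) (z - w) v := by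
      have h1 : HasFDerivAt (fun w => z - w) (-(ContinuousLinearMap.id ℝ ℂ)) w := by
        simpa using (hasFDerivAt_id w).const_sub z
      have h2 := (((contDiff_kernel k).differentiable (by simp)) (z - w)).hasFDerivAt.comp w h1
      have h3 : fderiv ℝ (kernelAt k z) w = _ := h2.fderiv
      rw [h3]
      simp
    simp only [this, ContinuousLinearMap.precompL_apply, lsmul_apply, neg_smul, neg_neg]
  · have hc := ((kernelBump k).hasCompactSupport_normed (μ := volume)).fderiv ℝ
    exact (HasCompactSupport.convolutionExists_left _ hc
      ((contDiff_kernel k).continuous_fderiv (by simp)) hg z).integrable_swap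

/-- When the kernel centred at `z` is supported in `Ω` it is itself an admissible test function, so
the definition of the weak derivative applies to it directly. -/
theorem HasWeakPartial.fderiv_mollify [CompleteSpace V] (h : HasWeakPartial Ω v F G)
    (hΩ : MeasurableSet Ω) (hF : IntegrableOn F Ω) {k : ℕ} {z : ℂ}
    (hz : closedBall z (1 / (k + 1 : ℝ)) ⊆ Ω) :
    fderiv ℝ (mollify k (Ω.indicator F)) z v = mollify k (Ω.indicator G) z := by
  have hs := (tsupport_kernelAt k z).trans hz
  have key : ∀ (a : ℂ → ℝ) (H : ℂ → V), tsupport a ⊆ Ω →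
      ∫ w, a w • Ω.indicator H w = ∫ w, a w • H w := by
    intro a H ha
    refine integral_congr_ae (Eventually.of_forall fun w => ?_)
    by_cases hw : w ∈ Ω
    · simp [hw]
    · have : a w = 0 := image_eq_zero_of_notMem_tsupport fun h => hw (ha h)
      simp [this]
  rw [QVal.fderiv_mollify k (hF.integrable_indicator hΩ).locallyIntegrable, mollify_apply,
    key _ _ hs, key _ _ ((tsupport_fderiv_apply _ v).trans hs),
    h.integral_eq (contDiff_kernelAt k z) (hasCompactSupport_kernelAt k z) hs, neg_neg]

theorem lintegral_enorm_kernel (k : ℕ) : ∫⁻ w, ‖(kernelBump k).normed volume w‖ₑ = 1 := by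
  rw [← ofReal_integral_norm_eq_lintegral_enorm (kernelBump k).integrable_normed]
  simp only [Real.norm_of_nonneg ((kernelBump k).nonneg_normed _), (kernelBump k).integral_normed,
    ENNReal.ofReal_one]

theorem integrable_mollify (k : ℕ) (hg : Integrable g) : Integrable (mollify k g) :=
  (kernelBump k).integrable_normed.integrable_convolution _ hg

theorem enorm_mollify_sub_le [CompleteSpace V] (k : ℕ) (hg : Integrable g) (z : ℂ) :
    ‖mollify k g z - g z‖ₑ ≤
      ∫⁻ w, ‖(kernelBump k).normed volume w‖ₑ * ‖g (z - w) - g z‖ₑ := by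
  have h1 : Integrable fun w => (kernelBump k).normed volume w • g (z - w) := by
    have := HasCompactSupport.convolutionExists_left (lsmul ℝ ℝ)
      ((kernelBump k).hasCompactSupport_normed (μ := volume)) (contDiff_kernel k).continuous
      hg.locallyIntegrable z (μ := volume)
    exact this
  have h2 : Integrable fun w => (kernelBump k).normed volume w • g z :=
    (kernelBump k).integrable_normed.smul_const _
  have h3 : mollify k g z - g z = ∫ w, (kernelBump k).normed volume w • (g (z - w) - g z) := by
    simp only [smul_sub]
    rw [integral_sub h1 h2, integral_smul_const, (kernelBump k).integral_normed, one_smul]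
    rfl
  rw [h3]
  refine (enorm_integral_le_lintegral_enorm _).trans_eq ?_
  simp only [enorm_smul]

/-- The kernel has mass one, so the error is an average of `g (z - w) - g z` over small `w`. By
Tonelli its `L¹` norm is an average of translation errors, which are small by continuity of
translation in `L¹`. -/
theorem tendsto_eLpNorm_mollify_sub [CompleteSpace V] (hg : Integrable g) :
    Tendsto (fun k => eLpNorm (fun z => mollify k g z - g z) 1 volume) atTop (𝓝 0) := by
  rw [ENNReal.tendsto_nhds_zero]
  intro ε hε
  have ht := (ENNReal.tendsto_nhds_zero.1 (tendsto_eLpNorm_translate_sub hg)) ε hε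
  obtain ⟨δ, hδ, h⟩ := Metric.eventually_nhds_iff.1 ht
  have hk : ∀ᶠ k : ℕ in atTop, 1 / (k + 1 : ℝ) < δ :=
    (tendsto_one_div_add_atTop_nhds_zero_nat (𝕜 := ℝ)).eventually (gt_mem_nhds hδ)
  filter_upwards [hk] with k hk
  have hmeas : AEStronglyMeasurable (fun p : ℂ × ℂ => g (p.1 - p.2)) (volume.prod volume) :=
    hg.aestronglyMeasurable.comp_quasiMeasurePreserving
      (quasiMeasurePreserving_sub_of_right_invariant volume volume)
  have hmeas2 : AEStronglyMeasurable (fun p : ℂ × ℂ => g p.1) (volume.prod volume) :=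
    hg.aestronglyMeasurable.comp_fst
  rw [eLpNorm_one_eq_lintegral_enorm]
  calc ∫⁻ z, ‖mollify k g z - g z‖ₑ
      ≤ ∫⁻ z, ∫⁻ w, ‖(kernelBump k).normed volume w‖ₑ * ‖g (z - w) - g z‖ₑ :=
        lintegral_mono fun z => enorm_mollify_sub_le k hg z
    _ = ∫⁻ w, ∫⁻ z, ‖(kernelBump k).normed volume w‖ₑ * ‖g (z - w) - g z‖ₑ := by
        refine lintegral_lintegral_swap ?_
        exact ((contDiff_kernel k).continuous.measurable.enorm.comp measurable_snd).aemeasurable.mul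
          (hmeas.sub hmeas2).enorm
    _ ≤ ∫⁻ w, ‖(kernelBump k).normed volume w‖ₑ * ε := by
        refine lintegral_mono fun w => ?_
        rw [lintegral_const_mul' _ _ enorm_ne_top]
        by_cases hw : (kernelBump k).normed volume w = 0
        · simp [hw]
        · gcongr
          have hw' : w ∈ Function.support ((kernelBump k).normed volume) := hw
          rw [(kernelBump k).support_normed_eq, mem_ball, dist_zero_right] at hw'
          have := @h (-w) (by rw [dist_zero_right, norm_neg]; exact hw'.trans hk)
          rw [eLpNorm_one_eq_lintegral_enorm] at this
          simpa only [← sub_eq_add_neg] using this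
    _ = ε := by
        rw [lintegral_mul_const _ (contDiff_kernel k).continuous.measurable.enorm,
          lintegral_enorm_kernel, one_mul]

/-- Difference quotients of a function with a continuous directional derivative. -/
theorem enorm_sub_smul_le_lintegral [CompleteSpace V] {f D : ℂ → V} (hf : ContDiff ℝ 1 f)
    (hD : Continuous D) {z v : ℂ} {t : ℝ}
    (h : ∀ s ∈ Set.Icc (0 : ℝ) 1, fderiv ℝ f (z + (s * t : ℝ) • v) v = D (z + (s * t : ℝ) • v)) :
    ‖f (z + t • v) - f z - t • D z‖ₑ ≤
      ‖t‖ₑ * ∫⁻ s in Set.Ioc (0 : ℝ) 1, ‖D (z + (s * t : ℝ) • v) - D z‖ₑ := by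
  have hderiv : ∀ s ∈ Set.uIcc (0 : ℝ) 1, HasDerivAt (fun s : ℝ => f (z + (s * t : ℝ) • v))
      (t • D (z + (s * t : ℝ) • v)) s := by
    intro s hs
    rw [Set.uIcc_of_le zero_le_one] at hs
    have h1 : HasDerivAt (fun s : ℝ => z + (s * t : ℝ) • v) (t • v) s := by
      have := (((hasDerivAt_id s).mul_const t).smul_const v).const_add z
      simpa using this
    have h2 := ((hf.differentiable (by simp)) (z + (s * t : ℝ) • v)).hasFDerivAt.comp_hasDerivAt s h1
    rwa [map_smul, h s hs] at h2
  have hint := intervalIntegral.integral_eq_sub_of_hasDerivAt hderiv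
    (Continuous.intervalIntegrable (by fun_prop) _ _)
  simp only [one_mul, zero_mul, zero_smul, add_zero] at hint
  have : f (z + t • v) - f z - t • D z
      = t • ∫ s in (0 : ℝ)..1, (D (z + (s * t : ℝ) • v) - D z) := by
    rw [← hint, intervalIntegral.integral_sub (Continuous.intervalIntegrable (by fun_prop) _ _)
      (by simp), intervalIntegral.integral_smul, smul_sub]
    simp
  rw [this, enorm_smul, intervalIntegral.integral_of_le zero_le_one]
  gcongr
  exact enorm_integral_le_lintegral_enorm _

omit [NormedSpace ℝ V] in
theorem eLpNorm_one_translate (hg : AEStronglyMeasurable g volume) (w : ℂ) :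
    eLpNorm (fun z => g (z + w)) 1 volume = eLpNorm g 1 volume := by
  have := eLpNorm_comp_measurePreserving (p := 1) hg
    (measurePreserving_add_right (volume : Measure ℂ) w)
  exact this

omit [NormedSpace ℝ V] in
theorem eLpNorm_translate_sub_le {A : ℂ → V} (hAm : AEStronglyMeasurable A volume)
    (hg : AEStronglyMeasurable g volume) (w : ℂ) :
    eLpNorm (fun z => A (z + w) - A z) 1 volume ≤
      2 * eLpNorm (fun z => A z - g z) 1 volume
        + eLpNorm (fun z => g (z + w) - g z) 1 volume := by
  have hmp := measurePreserving_add_right (volume : Measure ℂ) w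
  have hA : AEStronglyMeasurable (fun z => A z - g z) volume := hAm.sub hg
  have hA' : AEStronglyMeasurable (fun z => A (z + w) - g (z + w)) volume :=
    hA.comp_measurePreserving hmp
  have hB : AEStronglyMeasurable (fun z => g (z + w) - g z) volume :=
    (hg.comp_measurePreserving hmp).sub hg
  have e1 : eLpNorm (fun z => A (z + w) - g (z + w)) 1 volume
      = eLpNorm (fun z => A z - g z) 1 volume :=
    eLpNorm_one_translate hA w
  have e2 : (fun z => A (z + w) - A z)
      = ((fun z => A (z + w) - g (z + w)) + fun z => g (z + w) - g z)
        - fun z => A z - g z := by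
    funext z
    simp
  rw [e2]
  refine (eLpNorm_sub_le (hA'.add hB) hA le_rfl).trans ?_
  refine (add_le_add_left (eLpNorm_add_le hA' hB le_rfl) _).trans_eq ?_
  rw [e1, two_mul]
  abel

/-- Compares the difference quotient of `f` with that of a smooth approximation `A`, whose
derivative is approximated by `B`. The factors `t⁻¹` are harmless because `A` tends to `f` while `t`
stays fixed. -/
theorem eLpNorm_diffQuot_sub_le {A B f : ℂ → V} (hAm : AEStronglyMeasurable A volume)
    (hBm : AEStronglyMeasurable B volume) (hf : AEStronglyMeasurable f volume)
    (hg : AEStronglyMeasurable g volume) {t : ℝ} (ht0 : t ≠ 0) (w : ℂ) :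
    eLpNorm (fun z => t⁻¹ • (f (z + w) - f z) - g z) 1 (volume.restrict K) ≤
      eLpNorm (fun z => t⁻¹ • (A (z + w) - A z - t • B z)) 1 (volume.restrict K)
        + ‖t⁻¹‖ₑ * eLpNorm (fun z => A z - f z) 1 volume
        + ‖t⁻¹‖ₑ * eLpNorm (fun z => A z - f z) 1 volume
        + eLpNorm (fun z => B z - g z) 1 volume := by
  have hmp := measurePreserving_add_right (volume : Measure ℂ) w
  have hA : AEStronglyMeasurable (fun z => A z - f z) volume := hAm.sub hf
  have hA' : AEStronglyMeasurable (fun z => A (z + w) - f (z + w)) volume :=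
    hA.comp_measurePreserving hmp
  have hB : AEStronglyMeasurable (fun z => B z - g z) volume := hBm.sub hg
  have hC : AEStronglyMeasurable (fun z => t⁻¹ • (A (z + w) - A z - t • B z))
      (volume.restrict K) :=
    AEStronglyMeasurable.restrict ((((hAm.comp_measurePreserving hmp).sub hAm).sub
      (hBm.const_smul t)).const_smul t⁻¹)
  have e : (fun z => t⁻¹ • (f (z + w) - f z) - g z)
      = (((fun z => t⁻¹ • (A (z + w) - A z - t • B z))
        + t⁻¹ • fun z => A z - f z)
        - t⁻¹ • fun z => A (z + w) - f (z + w))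
        + fun z => B z - g z := by
    funext z
    simp only [Pi.add_apply, Pi.sub_apply, Pi.smul_apply, smul_sub, smul_smul,
      inv_mul_cancel₀ ht0, one_smul]
    abel
  have e1 : eLpNorm (fun z => A (z + w) - f (z + w)) 1 volume
      = eLpNorm (fun z => A z - f z) 1 volume :=
    eLpNorm_one_translate hA w
  have hr : ∀ {f : ℂ → V}, eLpNorm f 1 (volume.restrict K) ≤ eLpNorm f 1 volume :=
    eLpNorm_mono_measure _ Measure.restrict_le_self
  rw [e]
  refine (eLpNorm_add_le ((hC.add (hA.restrict.const_smul _)).sub (hA'.restrict.const_smul _))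
    hB.restrict le_rfl).trans (add_le_add ?_ hr)
  refine (eLpNorm_sub_le (hC.add (hA.restrict.const_smul _)) (hA'.restrict.const_smul _)
    le_rfl).trans (add_le_add ?_ ?_)
  · refine (eLpNorm_add_le hC (hA.restrict.const_smul _) le_rfl).trans (add_le_add le_rfl ?_)
    rw [eLpNorm_const_smul]
    exact mul_le_mul_right hr _
  · rw [eLpNorm_const_smul, ← e1]
    exact mul_le_mul_right hr _

/-- Difference quotients converge in `L¹` on compact sets to the weak derivative. -/
theorem HasWeakPartial.tendsto_eLpNorm_diffQuot [CompleteSpace V] (h : HasWeakPartial Ω v F G)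
    (hΩ : IsOpen Ω) (hF : IntegrableOn F Ω) (hG : IntegrableOn G Ω) (hK : IsCompact K)
    (hKΩ : K ⊆ Ω) :
    Tendsto (fun t : ℝ => eLpNorm (fun z => t⁻¹ • (Ω.indicator F (z + t • v) - Ω.indicator F z)
      - Ω.indicator G z) 1 (volume.restrict K)) (𝓝[≠] 0) (𝓝 0) := by
  set F₀ := Ω.indicator F
  set G₀ := Ω.indicator G
  have hF₀ : Integrable F₀ := hF.integrable_indicator hΩ.measurableSet
  have hG₀ : Integrable G₀ := hG.integrable_indicator hΩ.measurableSet
  obtain ⟨r, hr, hrΩ⟩ := hK.exists_cthickening_subset_open hΩ hKΩ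
  rw [ENNReal.tendsto_nhds_zero]
  intro ε hε
  obtain ⟨δ, hδ, hδε⟩ := Metric.eventually_nhds_iff.1
    ((ENNReal.tendsto_nhds_zero.1 (tendsto_eLpNorm_translate_sub hG₀)) ε hε)
  -- The bound by `δ` controls the translates of `G₀`. The bound by `r / 2`, together with a kernel
  -- radius below `r / 2`, keeps every kernel along the segments from `K` inside `Ω`.
  have hsmall : ∀ᶠ t : ℝ in 𝓝[≠] 0, |t| * ‖v‖ < min δ (r / 2) := by
    have : Tendsto (fun t : ℝ => |t| * ‖v‖) (𝓝 0) (𝓝 0) := by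
      exact Continuous.tendsto' (by fun_prop) _ _ (by simp)
    exact nhdsWithin_le_nhds (this.eventually (gt_mem_nhds (lt_min hδ (half_pos hr))))
  filter_upwards [hsmall, self_mem_nhdsWithin] with t ht ht0
  have ht0 : t ≠ 0 := ht0
  have hs_le : ∀ s ∈ Set.Icc (0 : ℝ) 1, ‖(s * t : ℝ) • v‖ < min δ (r / 2) := by
    intro s hs
    refine lt_of_le_of_lt ?_ ht
    rw [norm_smul, Real.norm_eq_abs, abs_mul, abs_of_nonneg hs.1]
    gcongr
    exact mul_le_of_le_one_left (abs_nonneg _) hs.2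
  have hk : ∀ᶠ k : ℕ in atTop, 1 / (k + 1 : ℝ) < r / 2 :=
    (tendsto_one_div_add_atTop_nhds_zero_nat (𝕜 := ℝ)).eventually (gt_mem_nhds (half_pos hr))
  -- Here `t` is fixed. Letting `k → ∞` removes all mollification errors, including those multiplied
  -- by `t⁻¹`, and leaves `ε`.
  have hbound : ∀ᶠ k : ℕ in atTop, eLpNorm (fun z => t⁻¹ • (F₀ (z + t • v) - F₀ z) - G₀ z) 1
      (volume.restrict K) ≤ ‖t⁻¹‖ₑ * (2 * eLpNorm (fun z => mollify k F₀ z - F₀ z) 1 volume)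
        + (3 * eLpNorm (fun z => mollify k G₀ z - G₀ z) 1 volume + ε) := by
    filter_upwards [hk] with k hk
    have hFk := (contDiff_mollify k hF₀.locallyIntegrable)
    have hGk := (contDiff_mollify k hG₀.locallyIntegrable)
    have hmain : eLpNorm (fun z => t⁻¹ • (mollify k F₀ (z + t • v) - mollify k F₀ z
        - t • mollify k G₀ z)) 1 (volume.restrict K)
        ≤ 2 * eLpNorm (fun z => mollify k G₀ z - G₀ z) 1 volume + ε := by
      rw [eLpNorm_one_eq_lintegral_enorm]
      calc ∫⁻ z in K, ‖t⁻¹ • (mollify k F₀ (z + t • v) - mollify k F₀ z - t • mollify k G₀ z)‖ₑ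
          ≤ ∫⁻ z in K, ∫⁻ s in Set.Ioc (0 : ℝ) 1,
              ‖mollify k G₀ (z + (s * t : ℝ) • v) - mollify k G₀ z‖ₑ := by
            refine setLIntegral_mono' hK.measurableSet fun z hz => ?_
            rw [enorm_smul]
            grw [enorm_sub_smul_le_lintegral (hFk.of_le (by simp)) hGk.continuous
              (fun s hs => ?_)]
            · rw [← mul_assoc, ← enorm_mul, inv_mul_cancel₀ ht0, enorm_one, one_mul]
            · refine h.fderiv_mollify hΩ.measurableSet hF fun w hw => hrΩ ?_
              refine mem_cthickening_of_dist_le w z r K hz ?_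
              have h1 := hs_le s hs
              have h2 : dist (z + (s * t : ℝ) • v) z < r / 2 := by
                rw [dist_eq_norm, add_sub_cancel_left]
                exact h1.trans_le (min_le_right _ _)
              have h3 := dist_triangle w (z + (s * t : ℝ) • v) z
              have h4 := mem_closedBall.1 hw
              linarith
        _ = ∫⁻ s in Set.Ioc (0 : ℝ) 1, ∫⁻ z in K,
              ‖mollify k G₀ (z + (s * t : ℝ) • v) - mollify k G₀ z‖ₑ := by
            refine lintegral_lintegral_swap (Continuous.aemeasurable ?_)
            have h2 := hGk.continuous
            simp only [Function.uncurry_def]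
            fun_prop
        _ ≤ ∫⁻ s in Set.Ioc (0 : ℝ) 1,
              (2 * eLpNorm (fun z => mollify k G₀ z - G₀ z) 1 volume + ε) := by
            refine setLIntegral_mono' measurableSet_Ioc fun s hs => ?_
            calc _ ≤ ∫⁻ z, ‖mollify k G₀ (z + (s * t : ℝ) • v) - mollify k G₀ z‖ₑ :=
                  setLIntegral_le_lintegral _ _
              _ = eLpNorm (fun z => mollify k G₀ (z + (s * t : ℝ) • v) - mollify k G₀ z) 1
                    volume := eLpNorm_one_eq_lintegral_enorm.symm
              _ ≤ _ := by
                grw [eLpNorm_translate_sub_le hGk.continuous.aestronglyMeasurable hG₀.aestronglyMeasurable]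
                gcongr
                apply hδε
                rw [dist_zero_right]
                exact (hs_le s ⟨hs.1.le, hs.2⟩).trans_le (min_le_left _ _)
        _ = _ := by simp
    refine (eLpNorm_diffQuot_sub_le hFk.continuous.aestronglyMeasurable
      hGk.continuous.aestronglyMeasurable hF₀.aestronglyMeasurable hG₀.aestronglyMeasurable
      ht0 (t • v)).trans ?_
    refine (add_le_add_left (add_le_add_left (add_le_add_left hmain _) _) _).trans (le_of_eq ?_)
    ring
  have hlim : Tendsto (fun k : ℕ => ‖t⁻¹‖ₑ * (2 * eLpNorm (fun z => mollify k F₀ z - F₀ z) 1 volume)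
        + (3 * eLpNorm (fun z => mollify k G₀ z - G₀ z) 1 volume + ε)) atTop (𝓝 ε) := by
    have h1 := ENNReal.Tendsto.const_mul (a := ‖t⁻¹‖ₑ) (ENNReal.Tendsto.const_mul (a := 2)
      (tendsto_eLpNorm_mollify_sub hF₀) (Or.inr (by simp))) (Or.inr enorm_ne_top)
    have h2 := ENNReal.Tendsto.const_mul (a := 3)
      (tendsto_eLpNorm_mollify_sub hG₀) (Or.inr (by simp))
    simpa using h1.add (h2.add_const ε)
  exact ge_of_tendsto hlim hbound

end Mollify
end QVal

namespace QVal

/-! ### Almost everywhere convergence of difference quotients and lengths of weak derivatives -/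

section DifferenceQuotients
open scoped ENNReal
variable {V V' V'' : Type*} [NormedAddCommGroup V] [NormedSpace ℝ V] [CompleteSpace V]
  [NormedAddCommGroup V'] [NormedSpace ℝ V'] [CompleteSpace V']
  [NormedAddCommGroup V''] [NormedSpace ℝ V''] [CompleteSpace V''] {Ω K : Set ℂ} {v : ℂ}

theorem ae_restrict_of_forall_isCompact (hΩ : IsOpen Ω) {P : ℂ → Prop}
    (h : ∀ K, IsCompact K → K ⊆ Ω → ∀ᵐ z ∂(volume.restrict K), P z) :
    ∀ᵐ z ∂(volume.restrict Ω), P z := by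
  rw [ae_restrict_iff' hΩ.measurableSet, ae_iff]
  refine measure_null_of_locally_null _ fun z hz => ?_
  obtain ⟨hzΩ, -⟩ := Classical.not_imp.1 hz
  obtain ⟨r, hr, hrΩ⟩ := Metric.nhds_basis_closedBall.mem_iff.1 (hΩ.mem_nhds hzΩ)
  refine ⟨{z | ¬ (z ∈ Ω → P z)} ∩ closedBall z r,
    inter_mem self_mem_nhdsWithin (nhdsWithin_le_nhds (closedBall_mem_nhds z hr)), ?_⟩
  have := h _ (isCompact_closedBall z r) hrΩ
  rw [ae_restrict_iff' measurableSet_closedBall, ae_iff] at this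
  refine measure_mono_null ?_ this
  rintro w ⟨hw, hwr⟩ hw'
  exact hw fun _ => hw' hwr

theorem HasWeakPartial.exists_subseq_ae_tendsto {F G : ℂ → V} (h : HasWeakPartial Ω v F G)
    (hΩ : IsOpen Ω) (hF : IntegrableOn F Ω) (hG : IntegrableOn G Ω) (hK : IsCompact K)
    (hKΩ : K ⊆ Ω) {t : ℕ → ℝ} (ht : Tendsto t atTop (𝓝[≠] 0)) :
    ∃ ns : ℕ → ℕ, StrictMono ns ∧ ∀ᵐ z ∂(volume.restrict K),
      Tendsto (fun k => (t (ns k))⁻¹ • (F (z + t (ns k) • v) - F z)) atTop (𝓝 (G z)) := by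
  have h1 := (h.tendsto_eLpNorm_diffQuot hΩ hF hG hK hKΩ).comp ht
  have hF₀ := (hF.integrable_indicator hΩ.measurableSet).aestronglyMeasurable
  have hG₀ := (hG.integrable_indicator hΩ.measurableSet).aestronglyMeasurable
  have h2 : TendstoInMeasure (volume.restrict K) (fun k z => (t k)⁻¹ •
      (Ω.indicator F (z + t k • v) - Ω.indicator F z)) atTop (Ω.indicator G) := by
    refine tendstoInMeasure_of_tendsto_eLpNorm (p := 1) one_ne_zero (fun k => ?_) hG₀.restrict h1
    have := hF₀.comp_measurePreserving
      (measurePreserving_add_right (volume : Measure ℂ) (t k • v))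
    exact AEStronglyMeasurable.restrict ((this.sub hF₀).const_smul _)
  obtain ⟨ns, hns, hlim⟩ := h2.exists_seq_tendsto_ae
  refine ⟨ns, hns, ?_⟩
  filter_upwards [hlim, ae_restrict_mem hK.measurableSet] with z hz hzK
  rw [← Set.indicator_of_mem (hKΩ hzK) G]
  refine hz.congr' ?_
  have h3 : Tendsto (fun k => z + t (ns k) • v) atTop (𝓝 z) := by
    have h4 : Tendsto (fun k => t (ns k)) atTop (𝓝 0) :=
      (ht.mono_right nhdsWithin_le_nhds).comp hns.tendsto_atTop
    simpa using (h4.smul_const v).const_add z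
  filter_upwards [h3.eventually (hΩ.mem_nhds (hKΩ hzK))] with k hk
  rw [Set.indicator_of_mem hk, Set.indicator_of_mem (hKΩ hzK)]

/-- If `F` and `F'` have increments of the same length at every point as soon as the increment of
`X` is small, then their weak derivatives have the same length. -/
theorem ae_norm_eq_of_norm_sub_eq {X H : ℂ → V} {F G : ℂ → V'} {F' G' : ℂ → V''}
    (hΩ : IsOpen Ω)
    (hX : HasWeakPartial Ω v X H) (hF : HasWeakPartial Ω v F G) (hF' : HasWeakPartial Ω v F' G')
    (iX : IntegrableOn X Ω) (iH : IntegrableOn H Ω) (iF : IntegrableOn F Ω)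
    (iG : IntegrableOn G Ω) (iF' : IntegrableOn F' Ω) (iG' : IntegrableOn G' Ω)
    (h : ∀ z, ∃ δ > 0, ∀ w, ‖X w - X z‖ < δ → ‖F w - F z‖ = ‖F' w - F' z‖) :
    ∀ᵐ z ∂(volume.restrict Ω), ‖G z‖ = ‖G' z‖ := by
  refine ae_restrict_of_forall_isCompact hΩ fun K hK hKΩ => ?_
  have ht0 : Tendsto (fun k : ℕ => 1 / (k + 1 : ℝ)) atTop (𝓝[≠] 0) := by
    refine tendsto_nhdsWithin_iff.2 ⟨tendsto_one_div_add_atTop_nhds_zero_nat, ?_⟩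
    exact Eventually.of_forall fun k => by
      have : (0 : ℝ) < 1 / (k + 1) := by positivity
      exact this.ne'
  -- Three successive extractions, so that one sequence of steps works for `X`, `F` and `F'`
  -- together.
  obtain ⟨n1, hn1, h1⟩ := hX.exists_subseq_ae_tendsto hΩ iX iH hK hKΩ ht0
  have ht1 := ht0.comp hn1.tendsto_atTop
  obtain ⟨n2, hn2, h2⟩ := hF.exists_subseq_ae_tendsto hΩ iF iG hK hKΩ ht1
  have ht2 := ht1.comp hn2.tendsto_atTop
  obtain ⟨n3, hn3, h3⟩ := hF'.exists_subseq_ae_tendsto hΩ iF' iG' hK hKΩ ht2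
  have ht3 := ht2.comp hn3.tendsto_atTop
  filter_upwards [h1, h2, h3] with z z1 z2 z3
  have z2' := z2.comp hn3.tendsto_atTop
  have z1' := z1.comp (hn2.comp hn3).tendsto_atTop
  -- A convergent difference quotient times a step tending to `0`: the increments of `X` tend to `0`
  -- along the sequence. This replaces continuity of `X` and brings the local hypothesis into force.
  have hX0 := (ht3.mono_right nhdsWithin_le_nhds).smul z1'
  rw [zero_smul] at hX0
  obtain ⟨δ, hδ, hδ'⟩ := h z
  have hev : ∀ᶠ k in atTop, ‖F (z + (1 / ((n1 (n2 (n3 k)) : ℕ) + 1 : ℝ)) • v) - F z‖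
      = ‖F' (z + (1 / ((n1 (n2 (n3 k)) : ℕ) + 1 : ℝ)) • v) - F' z‖ := by
    have := hX0.norm
    rw [norm_zero] at this
    filter_upwards [this.eventually (gt_mem_nhds hδ),
      (tendsto_nhdsWithin_iff.1 ht3).2] with k hk hk0
    apply hδ'
    refine lt_of_eq_of_lt ?_ hk
    have hk0' : (1 / ((n1 (n2 (n3 k)) : ℕ) + 1 : ℝ)) ≠ 0 := hk0
    simp only [Function.comp_apply, smul_smul]
    rw [mul_inv_cancel₀ hk0', one_smul]
  refine tendsto_nhds_unique z2'.norm (z3.norm.congr' ?_)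
  filter_upwards [hev] with k hk
  simp only [Function.comp_apply, norm_smul, hk]

end DifferenceQuotients

/-! ### Weak derivatives from an `L²` bound, by Riesz representation -/

section Riesz
variable {Ω : Set ℂ} {v : ℂ}

/-- The smooth functions with compact support in `Ω`. -/
def testFunctions (Ω : Set ℂ) : Submodule ℝ (ℂ → ℝ) where
  carrier := {η | ContDiff ℝ ∞ η ∧ HasCompactSupport η ∧ tsupport η ⊆ Ω}
  add_mem' := fun {a b} ha hb => ⟨ha.1.add hb.1, ha.2.1.add hb.2.1,
    (tsupport_add a b).trans (Set.union_subset ha.2.2 hb.2.2)⟩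
  zero_mem' := ⟨contDiff_const, HasCompactSupport.zero, by simp [tsupport]⟩
  smul_mem' := fun c a ha => ⟨contDiff_const.smul ha.1,
    ha.2.1.mono' ((Function.support_const_smul_subset c a).trans (subset_tsupport a)),
    (closure_mono (Function.support_const_smul_subset c a)).trans ha.2.2⟩

theorem memLp_testFunctions (η : testFunctions Ω) :
    MemLp (η : ℂ → ℝ) 2 (volume.restrict Ω) :=
  (η.2.1.continuous.memLp_of_hasCompactSupport η.2.2.1).restrict Ω

/-- Test functions as members of `L²`. -/
noncomputable def testToLp (Ω : Set ℂ) : testFunctions Ω →ₗ[ℝ] Lp ℝ 2 (volume.restrict Ω) where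
  toFun η := (memLp_testFunctions η).toLp
  map_add' a b := (memLp_testFunctions a).toLp_add (memLp_testFunctions b)
  map_smul' c a := (memLp_testFunctions a).toLp_const_smul c

theorem norm_testToLp (η : testFunctions Ω) :
    ‖testToLp Ω η‖ = (eLpNorm (η : ℂ → ℝ) 2 (volume.restrict Ω)).toReal :=
  Lp.norm_toLp _ (memLp_testFunctions η)

theorem testToLp_ae_eq (η : testFunctions Ω) :
    testToLp Ω η =ᵐ[volume.restrict Ω] (η : ℂ → ℝ) := (memLp_testFunctions η).coeFn_toLp

theorem integrable_fderiv_testFunctions_smul {F : ℂ → ℝ} (hF : LocallyIntegrableOn F Ω)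
    (η : testFunctions Ω) (v : ℂ) : Integrable fun z => fderiv ℝ (η : ℂ → ℝ) z v • F z :=
  integrable_smul_of_locallyIntegrableOn (continuous_fderiv_apply η.2.1 v)
    (hasCompactSupport_fderiv_apply η.2.2.1 v) ((tsupport_fderiv_apply _ v).trans η.2.2.2) hF

theorem differentiableAt_testFunctions (η : testFunctions Ω) (z : ℂ) :
    DifferentiableAt ℝ (η : ℂ → ℝ) z := (η.2.1.differentiable (by simp)) z

/-- The functional `η ↦ ∫ ∂_v η F`. -/
noncomputable def weakFunctional (v : ℂ) {F : ℂ → ℝ} (hF : LocallyIntegrableOn F Ω) :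
    testFunctions Ω →ₗ[ℝ] ℝ where
  toFun η := ∫ z, fderiv ℝ (η : ℂ → ℝ) z v • F z
  map_add' a b := by
    rw [← integral_add (integrable_fderiv_testFunctions_smul hF a v)
      (integrable_fderiv_testFunctions_smul hF b v)]
    refine integral_congr_ae (Eventually.of_forall fun z => ?_)
    have : fderiv ℝ ((a + b : testFunctions Ω) : ℂ → ℝ) z = _ :=
      fderiv_add (differentiableAt_testFunctions a z) (differentiableAt_testFunctions b z)
    simp only [this, _root_.add_apply, add_smul]
  map_smul' c a := by
    rw [RingHom.id_apply, ← integral_smul]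
    refine integral_congr_ae (Eventually.of_forall fun z => ?_)
    have : fderiv ℝ ((c • a : testFunctions Ω) : ℂ → ℝ) z = _ :=
      fderiv_const_smul (differentiableAt_testFunctions a z) c
    simp only [this, _root_.smul_apply, smul_assoc]

/-- A functional bounded on a subspace of a Hilbert space is represented by a vector. -/
theorem exists_inner_eq_of_norm_le {S H : Type*} [AddCommGroup S] [Module ℝ S]
    [NormedAddCommGroup H] [InnerProductSpace ℝ H] [CompleteSpace H] (T : S →ₗ[ℝ] H)
    (Λ : S →ₗ[ℝ] ℝ) (C : ℝ) (hΛ : ∀ η, ‖Λ η‖ ≤ C * ‖T η‖) :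
    ∃ G : H, ∀ η, Λ η = inner ℝ G (T η) := by
  -- A linear choice of preimages under `T`. The choice is immaterial, since the bound makes `Λ`
  -- vanish on the kernel of `T`.
  obtain ⟨g, hg⟩ := T.rangeRestrict.exists_rightInverse_of_surjective T.range_rangeRestrict
  have hTg : ∀ y : LinearMap.range T, T (g y) = y := fun y =>
    congrArg Subtype.val (LinearMap.congr_fun hg y)
  let Λ' : StrongDual ℝ (LinearMap.range T) := (Λ.comp g).mkContinuous C fun y => by
    have := hΛ (g y)
    rwa [hTg] at this
  obtain ⟨L, hL, -⟩ := exists_extension_norm_eq _ Λ'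
  refine ⟨(InnerProductSpace.toDual ℝ H).symm L, fun η => ?_⟩
  rw [InnerProductSpace.toDual_symm_apply]
  have h4 := hL ⟨T η, LinearMap.mem_range_self T η⟩
  rw [h4]
  change Λ η = Λ (g _)
  rw [← sub_eq_zero]
  have := hΛ (η - g ⟨T η, LinearMap.mem_range_self T η⟩)
  rw [map_sub T, hTg, sub_self, norm_zero, mul_zero] at this
  rw [← map_sub]
  exact norm_le_zero_iff.1 this

/-- A functional bound in `L²` produces a weak derivative. -/
theorem exists_hasWeakPartial_of_bound {F : ℂ → ℝ} (hF : LocallyIntegrableOn F Ω) (C : ℝ)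
    (hb : ∀ η : ℂ → ℝ, ContDiff ℝ ∞ η → HasCompactSupport η → tsupport η ⊆ Ω →
      |∫ z, fderiv ℝ η z v • F z| ≤ C * (eLpNorm η 2 (volume.restrict Ω)).toReal) :
    ∃ G, HasWeakPartial Ω v F G ∧ MemLp G 2 (volume.restrict Ω) := by
  obtain ⟨G, hG⟩ := exists_inner_eq_of_norm_le (testToLp Ω) (weakFunctional v hF) C fun η => by
    rw [norm_testToLp]
    exact hb η η.2.1 η.2.2.1 η.2.2.2
  refine ⟨fun z => -(G z), ?_, (Lp.memLp G).neg⟩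
  have hloc : LocallyIntegrableOn (fun z => -(G z)) Ω :=
    locallyIntegrableOn_of_locallyIntegrable_restrict
      ((Lp.memLp G).neg.locallyIntegrable (by norm_num))
  refine hasWeakPartial_of_integral hF hloc fun η h1 h2 h3 => ?_
  have e1 := hG ⟨η, h1, h2, h3⟩
  have e2 : inner ℝ G (testToLp Ω ⟨η, h1, h2, h3⟩) = ∫ z in Ω, η z • G z := by
    rw [L2.inner_def]
    refine integral_congr_ae ?_
    filter_upwards [testToLp_ae_eq ⟨η, h1, h2, h3⟩] with z hz
    rw [hz]
    simp
  have e3 : weakFunctional v hF ⟨η, h1, h2, h3⟩ = ∫ z, fderiv ℝ η z v • F z := rfl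
  rw [← e3, e1, e2, setIntegral_smul_eq_integral h3, ← integral_neg]
  simp

end Riesz

/-! ### Sobolev regularity from control of increments -/

section LipschitzComposition
open scoped ENNReal
variable {V : Type*} [NormedAddCommGroup V] [NormedSpace ℝ V] [CompleteSpace V] {Ω : Set ℂ} {v : ℂ}

omit [CompleteSpace V] in
theorem tendsto_integral_diffQuot_smul {η : ℂ → ℝ} (h1 : ContDiff ℝ ∞ η)
    (h2 : HasCompactSupport η) {F : ℂ → V} (hF : Integrable F) (v : ℂ) :
    Tendsto (fun t : ℝ => ∫ z, (t⁻¹ • (η (z + t • v) - η z)) • F z) (𝓝[≠] 0)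
      (𝓝 (∫ z, fderiv ℝ η z v • F z)) := by
  obtain ⟨C, hC⟩ := h1.lipschitzWith_of_hasCompactSupport h2 (by simp)
  refine tendsto_integral_filter_of_dominated_convergence (fun z => (C * ‖v‖) * ‖F z‖) ?_ ?_
    (hF.norm.const_mul _) ?_
  · refine Eventually.of_forall fun t => AEStronglyMeasurable.smul ?_ hF.aestronglyMeasurable
    have := h1.continuous
    exact Continuous.aestronglyMeasurable (by fun_prop)
  · filter_upwards [self_mem_nhdsWithin] with t ht
    refine Eventually.of_forall fun z => ?_
    have ht : t ≠ 0 := ht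
    rw [norm_smul, norm_smul]
    refine mul_le_mul_of_nonneg_right ?_ (norm_nonneg _)
    have := hC.norm_sub_le (z + t • v) z
    rw [add_sub_cancel_left, norm_smul] at this
    rw [norm_inv, inv_mul_le_iff₀ (norm_pos_iff.2 ht)]
    linarith
  · refine Eventually.of_forall fun z => ?_
    have h3 := ((h1.differentiable (by simp)) z).hasFDerivAt.hasLineDerivAt v
    have h4 := hasDerivAt_iff_tendsto_slope_zero.1 h3
    simp only [zero_add, zero_smul, add_zero] at h4
    exact h4.smul_const _

omit [CompleteSpace V] in
-- Discrete integration by parts, from translation invariance of the measure.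
theorem integral_diffQuot_smul {η : ℂ → ℝ} (h1 : ContDiff ℝ ∞ η)
    (h2 : HasCompactSupport η) {F : ℂ → V} (hF : Integrable F) (w : ℂ) :
    ∫ z, (η (z + w) - η z) • F z = ∫ z, η z • (F (z - w) - F z) := by
  obtain ⟨C, hC⟩ := h1.continuous.bounded_above_of_compact_support h2
  have i1 : Integrable fun z => η z • F z :=
    hF.bdd_smul C h1.continuous.aestronglyMeasurable (Eventually.of_forall hC)
  have i2 : Integrable fun z => η z • F (z - w) :=
    (hF.comp_sub_right w).bdd_smul C h1.continuous.aestronglyMeasurable (Eventually.of_forall hC)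
  have i3 : Integrable fun z => η (z + w) • F z :=
    hF.bdd_smul C (h1.continuous.comp (continuous_add_const w)).aestronglyMeasurable
      (Eventually.of_forall fun z => hC _)
  simp only [sub_smul, smul_sub]
  rw [integral_sub i3 i1, integral_sub i2 i1,
    ← integral_sub_right_eq_self (fun z => η (z + w) • F z) w]
  simp

/-- The derivative of `η` is replaced by difference quotients, which are moved onto `F`. There they
are at most `C` times those of `X`, and the latter converge to `G` in `L¹` on the support of `η`.
Moving the quotient reverses the step, whence `D (-t)`. -/
theorem abs_integral_fderiv_le {X G : ℂ → V} {F : ℂ → ℝ} (hΩ : IsOpen Ω)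
    (hX : HasWeakPartial Ω v X G) (iX : IntegrableOn X Ω) (iG : IntegrableOn G Ω)
    (iF : IntegrableOn F Ω) {C : ℝ} (hC : 0 ≤ C)
    (h : ∀ z w, |F z - F w| ≤ C * ‖X z - X w‖)
    {η : ℂ → ℝ} (h1 : ContDiff ℝ ∞ η) (h2 : HasCompactSupport η) (h3 : tsupport η ⊆ Ω) :
    |∫ z, fderiv ℝ η z v • F z| ≤ C * ∫ z, |η z| * ‖G z‖ := by
  set F₀ := Ω.indicator F
  set X₀ := Ω.indicator X
  set G₀ := Ω.indicator G
  set K := tsupport η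
  have hF₀ : Integrable F₀ := iF.integrable_indicator hΩ.measurableSet
  have hX₀ : Integrable X₀ := iX.integrable_indicator hΩ.measurableSet
  have hG₀ : Integrable G₀ := iG.integrable_indicator hΩ.measurableSet
  obtain ⟨M, hM⟩ := h1.continuous.bounded_above_of_compact_support h2
  have hηK : ∀ z, z ∉ K → η z = 0 := fun z hz => image_eq_zero_of_notMem_tsupport hz
  have hl := tendsto_integral_diffQuot_smul h1 h2 hF₀ v
  have el : ∫ z, fderiv ℝ η z v • F₀ z = ∫ z, fderiv ℝ η z v • F z := by
    refine integral_congr_ae (Eventually.of_forall fun z => ?_)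
    by_cases hz : z ∈ Ω
    · simp [F₀, hz]
    · have : fderiv ℝ η z v = 0 := image_eq_zero_of_notMem_tsupport
        (f := fun z => fderiv ℝ η z v) fun h' => hz (h3 (tsupport_fderiv_apply η v h'))
      simp [this]
  have eG : ∫ z, |η z| * ‖G z‖ = ∫ z, |η z| * ‖G₀ z‖ := by
    refine integral_congr_ae (Eventually.of_forall fun z => ?_)
    by_cases hz : z ∈ Ω
    · simp [G₀, hz]
    · simp [hηK z fun h' => hz (h3 h')]
  rw [el] at hl
  rw [eG]
  set D : ℝ → ℂ → V := fun t z => t⁻¹ • (X₀ (z + t • v) - X₀ z) - G₀ z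
  have hD : ∀ t, Integrable (D t) := fun t =>
    (((hX₀.comp_add_right _).sub hX₀).smul _).sub hG₀
  have hDlim : Tendsto (fun t : ℝ => C * (∫ z, |η z| * ‖G₀ z‖)
      + C * M * (eLpNorm (D (-t)) 1 (volume.restrict K)).toReal) (𝓝[≠] 0)
      (𝓝 (C * ∫ z, |η z| * ‖G₀ z‖)) := by
    have h5 := hX.tendsto_eLpNorm_diffQuot hΩ iX iG h2 h3
    have h6 : Tendsto (fun t : ℝ => -t) (𝓝[≠] 0) (𝓝[≠] 0) := by
      refine tendsto_nhdsWithin_iff.2 ⟨?_, ?_⟩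
      · exact (Continuous.tendsto' (by fun_prop) _ _ (by simp)).mono_left nhdsWithin_le_nhds
      · filter_upwards [self_mem_nhdsWithin] with t ht
        exact neg_ne_zero.2 ht
    have h7 := (ENNReal.tendsto_toReal ENNReal.zero_ne_top).comp (h5.comp h6)
    have h8 := (h7.const_mul (C * M)).const_add (C * ∫ z, |η z| * ‖G₀ z‖)
    rw [ENNReal.toReal_zero, mul_zero, add_zero] at h8
    exact h8
  obtain ⟨r, hr, hrΩ⟩ := h2.isCompact.exists_cthickening_subset_open hΩ h3
  have hsmall : ∀ᶠ t : ℝ in 𝓝[≠] 0, |t| * ‖v‖ < r := by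
    have : Tendsto (fun t : ℝ => |t| * ‖v‖) (𝓝 0) (𝓝 0) :=
      Continuous.tendsto' (by fun_prop) _ _ (by simp)
    exact nhdsWithin_le_nhds (this.eventually (gt_mem_nhds hr))
  refine le_of_tendsto_of_tendsto hl.abs hDlim ?_
  filter_upwards [hsmall, self_mem_nhdsWithin] with t ht ht0
  have ht0 : t ≠ 0 := ht0
  have e1 : ∫ z, (t⁻¹ • (η (z + t • v) - η z)) • F₀ z
      = ∫ z, t⁻¹ • (η z • (F₀ (z - t • v) - F₀ z)) := by
    rw [integral_smul, ← integral_diffQuot_smul h1 h2 hF₀, ← integral_smul]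
    simp only [smul_assoc]
  have hηG : Integrable fun z => |η z| * ‖G₀ z‖ := by
    refine hG₀.norm.bdd_mul (c := M) h1.continuous.abs.aestronglyMeasurable
      (Eventually.of_forall fun z => ?_)
    simpa using hM z
  have hb : Integrable fun z => C * (|η z| * ‖G₀ z‖) + C * M * K.indicator (fun z => ‖D (-t) z‖) z :=
    (hηG.const_mul C).add (((hD (-t)).norm.indicator h2.isCompact.measurableSet).const_mul _)
  rw [e1, ← Real.norm_eq_abs]
  refine (norm_integral_le_of_norm_le hb (Eventually.of_forall fun z => ?_)).trans_eq ?_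
  · by_cases hz : z ∈ K
    · have hz1 : z ∈ Ω := h3 hz
      have hz2 : z - t • v ∈ Ω := hrΩ <| by
        refine mem_cthickening_of_dist_le _ z r K hz ?_
        rw [dist_eq_norm, sub_sub_cancel_left, norm_neg, norm_smul]
        exact ht.le
      have h8 : |F₀ (z - t • v) - F₀ z| ≤ C * ‖X₀ (z - t • v) - X₀ z‖ := by
        simp only [F₀, X₀, Set.indicator_of_mem hz1, Set.indicator_of_mem hz2]
        exact h _ _
      have h9 : |t⁻¹| * ‖X₀ (z - t • v) - X₀ z‖ ≤ ‖G₀ z‖ + ‖D (-t) z‖ := by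
        have : (-t)⁻¹ • (X₀ (z - t • v) - X₀ z) = G₀ z + D (-t) z := by
          simp only [D, neg_smul, ← sub_eq_add_neg]
          abel
        have h10 := congrArg norm this
        rw [norm_smul, norm_inv, norm_neg] at h10
        rw [abs_inv, ← Real.norm_eq_abs, h10]
        exact norm_add_le _ _
      have hM' : |η z| ≤ M := hM z
      rw [Set.indicator_of_mem hz, norm_smul, norm_smul, Real.norm_eq_abs, Real.norm_eq_abs,
        Real.norm_eq_abs]
      calc |t⁻¹| * (|η z| * |F₀ (z - t • v) - F₀ z|)
          ≤ |t⁻¹| * (|η z| * (C * ‖X₀ (z - t • v) - X₀ z‖)) := by gcongr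
        _ = C * |η z| * (|t⁻¹| * ‖X₀ (z - t • v) - X₀ z‖) := by ring
        _ ≤ C * |η z| * (‖G₀ z‖ + ‖D (-t) z‖) := by gcongr
        _ ≤ C * (|η z| * ‖G₀ z‖) + C * M * ‖D (-t) z‖ := by
          have := mul_le_mul_of_nonneg_right (mul_le_mul_of_nonneg_left hM' hC)
            (norm_nonneg (D (-t) z))
          linarith
    · simp [hηK z hz, hz]
  · rw [integral_add (hηG.const_mul C)
      (((hD (-t)).norm.indicator h2.isCompact.measurableSet).const_mul _),
      integral_const_mul, integral_const_mul, integral_indicator h2.isCompact.measurableSet,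
      integral_norm_eq_lintegral_enorm (hD (-t)).aestronglyMeasurable.restrict,
      ← eLpNorm_one_eq_lintegral_enorm]

theorem memW12_of_abs_sub_le {X : ℂ → V} {F : ℂ → ℝ} (hΩ : IsOpen Ω)
    (hfin : IsFiniteMeasure (volume.restrict Ω)) (hX : MemW12 Ω X) {C : NNReal}
    (h : ∀ z w, |F z - F w| ≤ C * ‖X z - X w‖) : MemW12 Ω F := by
  -- Points with equal `X` have equal `F`, so `F` factors through `X` by a Lipschitz function on the
  -- range. Its Lipschitz extension yields measurability and square integrability of `F`.
  have hinv : ∀ y ∈ Set.range X, ∃ z, X z = y := fun y hy => hy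
  choose! s hs using hinv
  have hLip : LipschitzOnWith C (fun y => F (s y)) (Set.range X) := by
    refine LipschitzOnWith.of_dist_le_mul fun x hx y hy => ?_
    have := h (s x) (s y)
    rw [hs x hx, hs y hy] at this
    rwa [Real.dist_eq, dist_eq_norm]
  obtain ⟨g, hg, hgs⟩ := hLip.extend_real
  have hFg : F = fun z => g (X z) := by
    funext z
    rw [← hgs ⟨z, rfl⟩]
    have := h z (s (X z))
    rw [hs _ ⟨z, rfl⟩, sub_self, norm_zero, mul_zero] at this
    exact sub_eq_zero.1 (abs_nonpos_iff.1 this)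
  have hF2 : MemLp F 2 (volume.restrict Ω) := by
    -- Normalised to vanish at `0`, so that composition preserves `L²`. The constant `g 0` is added
    -- back using finiteness of the measure.
    have h0 : LipschitzWith C fun y => g y - g 0 := by
      refine LipschitzWith.of_dist_le_mul fun x y => ?_
      rw [dist_sub_right]
      exact hg.dist_le_mul x y
    have h1 := h0.comp_memLp (by simp) hX.1
    have h2 := h1.add (memLp_const (g 0))
    rw [hFg]
    refine (memLp_congr_ae (Eventually.of_forall fun z => ?_)).1 h2
    simp
  have iF : IntegrableOn F Ω := hF2.integrable (by norm_num)
  refine ⟨hF2, fun v hv => ?_⟩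
  obtain ⟨G, hG, hG2⟩ := hX.2 v hv
  refine exists_hasWeakPartial_of_bound iF.locallyIntegrableOn
    (C * (eLpNorm G 2 (volume.restrict Ω)).toReal) fun η h1 h2 h3 => ?_
  refine (abs_integral_fderiv_le hΩ hG (hX.1.integrable (by norm_num)) (hG2.integrable (by norm_num))
    iF C.2 h h1 h2 h3).trans ?_
  rw [mul_assoc]
  refine mul_le_mul_of_nonneg_left ?_ C.2
  have hη2 : MemLp η 2 (volume.restrict Ω) :=
    (h1.continuous.memLp_of_hasCompactSupport h2).restrict Ω
  have e1 : ∫ z, |η z| * ‖G z‖ = ∫ z in Ω, ‖η z • G z‖ := by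
    simp only [norm_smul, Real.norm_eq_abs]
    refine (setIntegral_eq_integral_of_forall_compl_eq_zero fun z hz => ?_).symm
    rw [image_eq_zero_of_notMem_tsupport fun h => hz (h3 h), abs_zero, zero_mul]
  rw [e1, integral_norm_eq_lintegral_enorm (f := fun z => η z • G z) (hη2.1.smul hG2.1), ← eLpNorm_one_eq_lintegral_enorm,
    mul_comm, ← ENNReal.toReal_mul]
  refine ENNReal.toReal_mono (ENNReal.mul_ne_top hη2.2.ne hG2.2.ne) ?_
  exact eLpNorm_smul_le_mul_eLpNorm hG2.1 hη2.1

omit [CompleteSpace V] in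
theorem memW12_zero : MemW12 Ω (fun _ => (0 : V)) :=
  ⟨MemLp.zero', fun v _ => ⟨fun _ => 0, ⟨locallyIntegrableOn_zero, locallyIntegrableOn_zero, by simp⟩,
    MemLp.zero'⟩⟩

omit [CompleteSpace V] in
theorem memW12_finset_sum {ι : Type*} (s : Finset ι) {F : ι → ℂ → V}
    (h : ∀ i ∈ s, MemW12 Ω (F i)) : MemW12 Ω fun z => ∑ i ∈ s, F i z := by
  classical
  induction s using Finset.induction_on with
  | empty => simpa using memW12_zero
  | insert i s hi ih =>
    simp only [Finset.sum_insert hi]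
    exact (h i (Finset.mem_insert_self i s)).add (ih fun j hj => h j (Finset.mem_insert_of_mem hj))

/-- Functions whose increments are controlled by those of a Sobolev function are Sobolev. -/
theorem memW12_of_norm_sub_le {ι : Type*} [Fintype ι] {X : ℂ → V} {F : ℂ → EuclideanSpace ℝ ι}
    (hΩ : IsOpen Ω) (hfin : IsFiniteMeasure (volume.restrict Ω)) (hX : MemW12 Ω X) {C : NNReal}
    (h : ∀ z w, ‖F z - F w‖ ≤ C * ‖X z - X w‖) : MemW12 Ω F := by
  classical
  have h1 : ∀ i, MemW12 Ω fun z => F z i := fun i =>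
    memW12_of_abs_sub_le hΩ hfin hX fun z w =>
      (PiLp.norm_apply_le (F z - F w) i).trans (h z w)
  have h2 := memW12_finset_sum Finset.univ fun i _ => (h1 i).clm_comp
    (ContinuousLinearMap.toSpanSingleton ℝ (EuclideanSpace.single i (1 : ℝ)))
  have e : F = fun z => ∑ i, ContinuousLinearMap.toSpanSingleton ℝ
      (EuclideanSpace.single i (1 : ℝ)) (F z i) := by
    funext z
    ext j
    simp [Finset.sum_apply, Pi.single_apply]
  rw [e]
  exact h2

end LipschitzComposition
end QVal

namespace QVal

/-! ### Domain variations in a fixed direction -/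

section Shear
open scoped ENNReal NNReal
variable {η : ℂ → ℝ} {a : ℂ} {t : ℝ} {L : ℝ≥0} {Ω : Set ℂ}

/-- The domain variation in the fixed direction `a` with profile `η`. -/
noncomputable def shear (η : ℂ → ℝ) (a : ℂ) (t : ℝ) (z : ℂ) : ℂ := z + t • (η z • a)

/-- The differential of `shear`. -/
noncomputable def shearDeriv (η : ℂ → ℝ) (a : ℂ) (t : ℝ) (z : ℂ) : ℂ →L[ℝ] ℂ :=
  ContinuousLinearMap.id ℝ ℂ + t • (fderiv ℝ η z).smulRight a

theorem shearDeriv_apply (η : ℂ → ℝ) (a : ℂ) (t : ℝ) (z v : ℂ) :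
    shearDeriv η a t z v = v + (t * fderiv ℝ η z v) • a := by
  simp [shearDeriv, mul_assoc]

theorem hasFDerivAt_shear (h1 : ContDiff ℝ ∞ η) (a : ℂ) (t : ℝ) (z : ℂ) :
    HasFDerivAt (shear η a t) (shearDeriv η a t z) z :=
  (hasFDerivAt_id z).add
    ((((h1.differentiable (by simp)) z).hasFDerivAt.smul_const a).const_smul t)

theorem contDiff_shear (h1 : ContDiff ℝ ∞ η) (a : ℂ) (t : ℝ) : ContDiff ℝ ∞ (shear η a t) := by
  unfold shear
  fun_prop

/-- The differential is the identity plus an operator of rank one, that is, a transvection in the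
sense of `LinearMap.transvection`. -/
theorem det_shearDeriv (η : ℂ → ℝ) (a : ℂ) (t : ℝ) (z : ℂ) :
    (shearDeriv η a t z).det = 1 + t * fderiv ℝ η z a := by
  have : ((shearDeriv η a t z : ℂ →L[ℝ] ℂ) : ℂ →ₗ[ℝ] ℂ)
      = LinearMap.transvection (t • (fderiv ℝ η z : ℂ →ₗ[ℝ] ℝ)) a := by
    refine LinearMap.ext fun v => ?_
    exact shearDeriv_apply η a t z v
  rw [ContinuousLinearMap.det, this, LinearMap.transvection.det]
  simp

theorem abs_mul_fderiv_le (hL : LipschitzWith L η) (ha : ‖a‖ = 1) (ht : |t| * L ≤ 1 / 2) (z : ℂ) :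
    |t * fderiv ℝ η z a| ≤ 1 / 2 := by
  have h := (fderiv ℝ η z).le_opNorm a
  rw [ha, mul_one] at h
  rw [abs_mul]
  refine le_trans ?_ ht
  gcongr
  exact h.trans (norm_fderiv_le_of_lipschitz ℝ hL)

theorem half_le_det (hL : LipschitzWith L η) (ha : ‖a‖ = 1) (ht : |t| * L ≤ 1 / 2) (z : ℂ) :
    1 / 2 ≤ (shearDeriv η a t z).det := by
  rw [det_shearDeriv]
  have := abs_le.1 (abs_mul_fderiv_le hL ha ht z)
  linarith

/-- Small domain variations are homeomorphisms of the plane. -/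
theorem exists_shear_inverse (hL : LipschitzWith L η) (ha : ‖a‖ = 1) (ht : |t| * L ≤ 1 / 2) :
    ∃ Y : ℂ → ℂ, Continuous Y ∧ Function.LeftInverse Y (shear η a t) ∧
      Function.RightInverse Y (shear η a t) := by
  -- The map differs from the identity by a `1/2`-Lipschitz map, and `1/2` is below the threshold
  -- `1` at which such a perturbation may fail to be invertible.
  have happ : ApproximatesLinearOn (shear η a t)
      ((ContinuousLinearEquiv.refl ℝ ℂ : ℂ ≃L[ℝ] ℂ) : ℂ →L[ℝ] ℂ) Set.univ (1 / 2 : ℝ≥0) := by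
    intro x _ y _
    have e : shear η a t x - shear η a t y - (x - y) = (t * (η x - η y)) • a := by
      simp only [shear, smul_smul, mul_sub, sub_smul]
      abel
    have h2 := hL.norm_sub_le x y
    change ‖shear η a t x - shear η a t y - (x - y)‖ ≤ _
    rw [e, norm_smul, ha, mul_one, norm_mul]
    calc ‖t‖ * ‖η x - η y‖ ≤ ‖t‖ * (L * ‖x - y‖) := by gcongr
      _ = (|t| * L) * ‖x - y‖ := by rw [Real.norm_eq_abs]; ring
      _ ≤ 1 / 2 * ‖x - y‖ := by gcongr
      _ = _ := by simp
  have hc : Subsingleton ℂ ∨ (1 / 2 : ℝ≥0) <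
      ‖((ContinuousLinearEquiv.refl ℝ ℂ).symm : ℂ →L[ℝ] ℂ)‖₊⁻¹ := by
    right
    have : ‖((ContinuousLinearEquiv.refl ℝ ℂ).symm : ℂ →L[ℝ] ℂ)‖₊ = 1 := by
      ext
      exact ContinuousLinearMap.norm_id
    rw [this, inv_one]
    exact NNReal.half_lt_self one_ne_zero
  let e := happ.toHomeomorph _ hc
  exact ⟨e.symm, e.symm.continuous, e.left_inv, e.right_inv⟩

theorem shear_eq_self {z : ℂ} (hz : z ∉ tsupport η) : shear η a t z = z := by
  simp [shear, image_eq_zero_of_notMem_tsupport hz]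

theorem shear_mem_iff (hi : Function.Injective (shear η a t)) (hs : tsupport η ⊆ Ω) {z : ℂ} :
    shear η a t z ∈ Ω ↔ z ∈ Ω := by
  by_cases hz : z ∈ tsupport η
  · refine iff_of_true (hs ?_) (hs hz)
    by_contra h
    rw [hi (shear_eq_self h)] at h
    exact h hz
  · rw [shear_eq_self hz]

/-- The Jacobian is at least `1/2`. As a result, composition with the variation is bounded on `L¹`,
even for functions that are merely integrable. -/
theorem map_shear_le (h1 : ContDiff ℝ ∞ η) (hL : LipschitzWith L η) (ha : ‖a‖ = 1)
    (ht : |t| * L ≤ 1 / 2) :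
    Measure.map (shear η a t) (volume : Measure ℂ) ≤ (2 : ℝ≥0∞) • volume := by
  have hc := (contDiff_shear h1 a t).continuous
  obtain ⟨Y, -, hl, hr⟩ := exists_shear_inverse hL ha ht
  refine Measure.le_iff.2 fun s hs => ?_
  have hm : MeasurableSet (shear η a t ⁻¹' s) := hc.measurable hs
  rw [Measure.map_apply hc.measurable hs, Measure.smul_apply, smul_eq_mul]
  have h2 := lintegral_abs_det_fderiv_eq_addHaar_image volume hm
    (fun x _ => (hasFDerivAt_shear h1 a t x).hasFDerivWithinAt) hl.injective.injOn
  rw [Set.image_preimage_eq s hr.surjective] at h2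
  rw [← h2]
  calc volume (shear η a t ⁻¹' s) = 2 * ∫⁻ x in shear η a t ⁻¹' s, ENNReal.ofReal (1 / 2) := by
        rw [setLIntegral_const, ← mul_assoc, ← ENNReal.ofReal_ofNat 2,
          ← ENNReal.ofReal_mul (by norm_num)]
        norm_num
    _ ≤ _ := by
        gcongr with x
        exact (half_le_det hL ha ht x).trans (le_abs_self _)

end Shear

/-! ### Chain rule for weak derivatives under domain variations -/

section ChainRule
open scoped ENNReal NNReal
variable {V : Type*} [NormedAddCommGroup V] [NormedSpace ℝ V]
  {η : ℂ → ℝ} {a v : ℂ} {t : ℝ} {L : ℝ≥0} {Ω : Set ℂ} {X : ℂ → ℂ}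

omit [NormedSpace ℝ V] in
theorem integrable_comp_of_map_le (hX : Continuous X)
    (hm : Measure.map X (volume : Measure ℂ) ≤ (2 : ℝ≥0∞) • volume) {g : ℂ → V}
    (hg : Integrable g) : Integrable fun z => g (X z) := by
  have h1 : Integrable g (Measure.map X volume) :=
    (hg.smul_measure (by simp : (2 : ℝ≥0∞) ≠ ⊤)).mono_measure hm
  exact h1.comp_measurable hX.measurable

omit [NormedSpace ℝ V] in
theorem lintegral_comp_le_of_map_le (hX : Continuous X)
    (hm : Measure.map X (volume : Measure ℂ) ≤ (2 : ℝ≥0∞) • volume) {g : ℂ → V}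
    (hg : Integrable g) : ∫⁻ z, ‖g (X z)‖ₑ ≤ 2 * ∫⁻ z, ‖g z‖ₑ := by
  have h1 : AEMeasurable (fun z => ‖g z‖ₑ) (Measure.map X volume) :=
    ((hg.smul_measure (by simp : (2 : ℝ≥0∞) ≠ ⊤)).mono_measure hm).aestronglyMeasurable.enorm
  rw [← lintegral_map' h1 hX.aemeasurable, ← smul_eq_mul, ← lintegral_smul_measure]
  exact lintegral_mono' hm le_rfl

/-- The bound on the pushforward carries the `L¹` convergence of mollifications through the
composition, and `α` is bounded. -/
theorem tendsto_integral_smul_mollify_comp [CompleteSpace V] (hX : Continuous X)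
    (hm : Measure.map X (volume : Measure ℂ) ≤ (2 : ℝ≥0∞) • volume) {g : ℂ → V}
    (hg : Integrable g) {α : ℂ → ℝ} (hα : Continuous α) (hαc : HasCompactSupport α) :
    Tendsto (fun k => ∫ z, α z • mollify k g (X z)) atTop (𝓝 (∫ z, α z • g (X z))) := by
  obtain ⟨M, hM⟩ := hα.bounded_above_of_compact_support hαc
  have hi : ∀ {h : ℂ → V}, Integrable h → Integrable fun z => α z • h (X z) := fun h' =>
    (integrable_comp_of_map_le hX hm h').bdd_smul M hα.aestronglyMeasurable
      (Eventually.of_forall hM)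
  have hM0 : 0 ≤ M := (norm_nonneg _).trans (hM 0)
  refine tendsto_integral_of_L1 _ (hi hg).aestronglyMeasurable
    (Eventually.of_forall fun k => hi (integrable_mollify k hg)) ?_
  have h0 := ENNReal.Tendsto.const_mul (a := ENNReal.ofReal M * 2) (tendsto_eLpNorm_mollify_sub hg)
    (Or.inr (ENNReal.mul_ne_top ENNReal.ofReal_ne_top (by simp)))
  rw [mul_zero] at h0
  refine tendsto_of_tendsto_of_tendsto_of_le_of_le tendsto_const_nhds h0 (fun _ => zero_le) fun k => ?_
  have h2 := lintegral_comp_le_of_map_le hX hm ((integrable_mollify k hg).sub hg)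
  simp only [eLpNorm_one_eq_lintegral_enorm]
  calc ∫⁻ z, ‖α z • mollify k g (X z) - α z • g (X z)‖ₑ
      ≤ ∫⁻ z, ENNReal.ofReal M * ‖(mollify k g - g) (X z)‖ₑ := by
        refine lintegral_mono fun z => ?_
        rw [← smul_sub, enorm_smul]
        refine mul_le_mul_left ?_ _
        rw [← ofReal_norm]
        exact ENNReal.ofReal_le_ofReal (hM z)
    _ = ENNReal.ofReal M * ∫⁻ z, ‖(mollify k g - g) (X z)‖ₑ :=
        lintegral_const_mul' _ _ ENNReal.ofReal_ne_top
    _ ≤ ENNReal.ofReal M * (2 * ∫⁻ z, ‖(mollify k g - g) z‖ₑ) := by gcongr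
    _ = _ := by rw [mul_assoc]; rfl

/-- The chain rule for weak derivatives under small domain variations. -/
theorem HasWeakPartial.comp_shear [CompleteSpace V] {F G H : ℂ → V} (hΩ : IsOpen Ω)
    (hv : HasWeakPartial Ω v F G) (hw : HasWeakPartial Ω a F H)
    (iF : IntegrableOn F Ω) (iG : IntegrableOn G Ω) (iH : IntegrableOn H Ω)
    (h1 : ContDiff ℝ ∞ η) (h2 : HasCompactSupport η) (h3 : tsupport η ⊆ Ω)
    (hL : LipschitzWith L η) (ha : ‖a‖ = 1) (ht : |t| * L ≤ 1 / 2) :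
    HasWeakPartial Ω v (fun z => F (shear η a t z))
      (fun z => G (shear η a t z) + (t * fderiv ℝ η z v) • H (shear η a t z)) := by
  obtain ⟨Y, -, hl, -⟩ := exists_shear_inverse hL ha ht
  have hc := (contDiff_shear h1 a t).continuous
  have hm := map_shear_le h1 hL ha ht
  have hmem : ∀ {z}, z ∈ Ω → shear η a t z ∈ Ω := fun {z} => (shear_mem_iff hl.injective h3).2
  have iF₀ := iF.integrable_indicator hΩ.measurableSet
  have iG₀ := iG.integrable_indicator hΩ.measurableSet
  have iH₀ := iH.integrable_indicator hΩ.measurableSet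
  have hloc : ∀ {g : ℂ → V}, Integrable (Ω.indicator g) →
      IntegrableOn (fun z => g (shear η a t z)) Ω := by
    intro g hg
    refine (integrable_comp_of_map_le hc hm hg).integrableOn.congr_fun (fun z hz => ?_)
      hΩ.measurableSet
    exact Set.indicator_of_mem (hmem hz) g
  have hη' := continuous_fderiv_apply h1 v
  obtain ⟨M, hM⟩ := hη'.bounded_above_of_compact_support (hasCompactSupport_fderiv_apply h2 v)
  have iHη : IntegrableOn (fun z => (t * fderiv ℝ η z v) • H (shear η a t z)) Ω := by
    refine (hloc iH₀).bdd_smul (|t| * M) (hη'.const_mul t).aestronglyMeasurable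
      (Eventually.of_forall fun z => ?_)
    rw [norm_mul]
    exact mul_le_mul_of_nonneg_left (hM z) (abs_nonneg t)
  refine hasWeakPartial_of_integral (hloc iF₀).locallyIntegrableOn
    ((hloc iG₀).add iHη).locallyIntegrableOn fun ζ ζ1 ζ2 ζ3 => ?_
  have hind : ∀ (α : ℂ → ℝ) (g : ℂ → V), tsupport α ⊆ Ω →
      ∫ z, α z • Ω.indicator g (shear η a t z) = ∫ z, α z • g (shear η a t z) := by
    intro α g hα
    refine integral_congr_ae (Eventually.of_forall fun z => ?_)
    by_cases hz : z ∈ Ω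
    · simp [hmem hz]
    · simp [image_eq_zero_of_notMem_tsupport fun h => hz (hα h)]
  have ζ1' := continuous_fderiv_apply ζ1 v
  have ζ2' := hasCompactSupport_fderiv_apply ζ2 v
  have ζ3' := (tsupport_fderiv_apply ζ v).trans ζ3
  set β : ℂ → ℝ := fun z => ζ z * (t * fderiv ℝ η z v)
  have hβ : Continuous β := ζ1.continuous.mul (hη'.const_mul t)
  have hβc : HasCompactSupport β := ζ2.mul_right
  have hβs : tsupport β ⊆ Ω := (tsupport_mul_subset_left).trans ζ3
  have hlimF := tendsto_integral_smul_mollify_comp hc hm iF₀ ζ1' ζ2'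
  have hlimG := tendsto_integral_smul_mollify_comp hc hm iG₀ ζ1.continuous ζ2
  have hlimH := tendsto_integral_smul_mollify_comp hc hm iH₀ hβ hβc
  rw [hind _ _ ζ3'] at hlimF
  rw [hind _ _ ζ3] at hlimG
  rw [hind _ _ hβs] at hlimH
  have hR : ∫ z, ζ z • (G (shear η a t z) + (t * fderiv ℝ η z v) • H (shear η a t z))
      = (∫ z, ζ z • G (shear η a t z)) + ∫ z, β z • H (shear η a t z) := by
    simp only [smul_add, smul_smul]
    exact integral_add
      (integrable_smul_of_locallyIntegrableOn ζ1.continuous ζ2 ζ3 (hloc iG₀).locallyIntegrableOn)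
      (integrable_smul_of_locallyIntegrableOn hβ hβc hβs (hloc iH₀).locallyIntegrableOn)
  rw [hR]
  refine tendsto_nhds_unique hlimF (((hlimG.add hlimH).neg).congr' ?_)
  -- On the image of the support of `ζ`, kernels of radius below `r` stay in `Ω`. There the
  -- classical chain rule for the mollified `F` involves exactly the mollified `G` and `H`, and the
  -- identity passes to the limit.
  obtain ⟨r, hr, hrΩ⟩ := (ζ2.isCompact.image hc).exists_cthickening_subset_open hΩ
    (Set.image_subset_iff.2 fun z hz => hmem (ζ3 hz))
  have hk : ∀ᶠ k : ℕ in atTop, 1 / (k + 1 : ℝ) < r :=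
    (tendsto_one_div_add_atTop_nhds_zero_nat (𝕜 := ℝ)).eventually (gt_mem_nhds hr)
  filter_upwards [hk] with k hk
  have sF := contDiff_mollify k iF₀.locallyIntegrable
  have sG := contDiff_mollify k iG₀.locallyIntegrable
  have sH := contDiff_mollify k iH₀.locallyIntegrable
  have hcomp : ContDiff ℝ ∞ fun z => mollify k (Ω.indicator F) (shear η a t z) :=
    sF.comp (contDiff_shear h1 a t)
  have hpart := (hasWeakPartial_of_contDiffOn hΩ (hcomp.of_le (by simp)).contDiffOn v).integral_eq
    ζ1 ζ2 ζ3
  rw [hpart, ← integral_add]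
  · congr 1
    refine integral_congr_ae (Eventually.of_forall fun z => ?_)
    by_cases hz : z ∈ tsupport ζ
    · have hball : closedBall (shear η a t z) (1 / (k + 1 : ℝ)) ⊆ Ω := fun w hw => hrΩ <|
        mem_cthickening_of_dist_le w _ r _ (Set.mem_image_of_mem _ hz)
          ((mem_closedBall.1 hw).trans hk.le)
      have hd := ((sF.differentiable (by simp)) (shear η a t z)).hasFDerivAt.comp z
        (hasFDerivAt_shear h1 a t z)
      have hd' : fderiv ℝ (fun z => mollify k (Ω.indicator F) (shear η a t z)) z = _ := hd.fderiv
      simp only [hd', ContinuousLinearMap.comp_apply, shearDeriv_apply, map_add, map_smul,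
        hv.fderiv_mollify hΩ.measurableSet iF hball, hw.fderiv_mollify hΩ.measurableSet iF hball, β,
        smul_add, smul_smul]
    · simp [β, image_eq_zero_of_notMem_tsupport hz]
  · exact integrable_smul_of_locallyIntegrableOn ζ1.continuous ζ2 ζ3
      ((sG.continuous.comp hc).continuousOn.locallyIntegrableOn hΩ.measurableSet)
  · exact integrable_smul_of_locallyIntegrableOn hβ hβc hβs
      ((sH.continuous.comp hc).continuousOn.locallyIntegrableOn hΩ.measurableSet)

end ChainRule
end QVal

namespace QVal

/-! ### First variation of the energy -/

section EnergyVariation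
open scoped ENNReal NNReal
variable {V : Type*} [NormedAddCommGroup V] [InnerProductSpace ℝ V]
  {η : ℂ → ℝ} {a : ℂ} {t : ℝ} {L : ℝ≥0} {Ω : Set ℂ} {F G₁ G₂ H : ℂ → V}

/-- The difference quotient of the energy density under a domain variation, after the change of
variables; `β₁, β₂, γ` are the derivatives of the profile and `g₁, g₂, h` the weak derivatives. -/
noncomputable def energyQuot (t β₁ β₂ γ : ℝ) (g₁ g₂ h : V) : ℝ :=
  (2 * β₁ * inner ℝ g₁ h + 2 * β₂ * inner ℝ g₂ h + t * (β₁ ^ 2 + β₂ ^ 2) * ‖h‖ ^ 2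
    - γ * (‖g₁‖ ^ 2 + ‖g₂‖ ^ 2)) * (1 + t * γ)⁻¹

/-- An exact identity with the factor `t` split off, so that dividing the energy difference by `t`
leaves no remainder to estimate. -/
theorem energy_eq_add_mul_energyQuot {t β₁ β₂ γ : ℝ} (h0 : 1 + t * γ ≠ 0) (g₁ g₂ h : V) :
    (‖g₁ + (t * β₁) • h‖ ^ 2 + ‖g₂ + (t * β₂) • h‖ ^ 2) * (1 + t * γ)⁻¹
      = ‖g₁‖ ^ 2 + ‖g₂‖ ^ 2 + t * energyQuot t β₁ β₂ γ g₁ g₂ h := by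
  rw [norm_add_sq_real, norm_add_sq_real, norm_smul, norm_smul, inner_smul_right, inner_smul_right,
    energyQuot, mul_pow, mul_pow, Real.norm_eq_abs, Real.norm_eq_abs, sq_abs, sq_abs]
  field_simp
  ring

theorem abs_energyQuot_le {t β₁ β₂ γ M : ℝ} (ht : |t| ≤ 1) (h0 : 1 / 2 ≤ 1 + t * γ)
    (h₁ : |β₁| ≤ M) (h₂ : |β₂| ≤ M) (h₃ : |γ| ≤ M) (g₁ g₂ h : V) :
    |energyQuot t β₁ β₂ γ g₁ g₂ h| ≤
      (2 * M * (‖g₁‖ ^ 2 + ‖g₂‖ ^ 2 + ‖h‖ ^ 2) + 2 * M ^ 2 * ‖h‖ ^ 2) * 2 := by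
  have hM : 0 ≤ M := (abs_nonneg _).trans h₁
  have hJ : |(1 + t * γ)⁻¹| ≤ 2 := by
    rw [abs_inv, abs_of_pos (by linarith)]
    exact inv_le_of_inv_le₀ (by norm_num) (by linarith)
  have hin : ∀ g : V, |inner ℝ g h| ≤ (‖g‖ ^ 2 + ‖h‖ ^ 2) / 2 := fun g => by
    have := abs_real_inner_le_norm g h
    nlinarith [sq_nonneg (‖g‖ - ‖h‖)]
  have hb : ∀ (β : ℝ) (g : V), |β| ≤ M → |2 * β * inner ℝ g h| ≤ M * (‖g‖ ^ 2 + ‖h‖ ^ 2) := by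
    intro β g hβ
    rw [abs_mul, abs_mul, abs_two]
    calc 2 * |β| * |inner ℝ g h| ≤ 2 * M * ((‖g‖ ^ 2 + ‖h‖ ^ 2) / 2) := by
          gcongr
          exact hin g
      _ = _ := by ring
  have hsq : ∀ β : ℝ, |β| ≤ M → β ^ 2 ≤ M ^ 2 := fun β hβ => by
    rw [← sq_abs]
    gcongr
  have hc : |t * (β₁ ^ 2 + β₂ ^ 2) * ‖h‖ ^ 2| ≤ 2 * M ^ 2 * ‖h‖ ^ 2 := by
    rw [abs_mul, abs_mul, abs_of_nonneg (sq_nonneg ‖h‖),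
      abs_of_nonneg (add_nonneg (sq_nonneg β₁) (sq_nonneg β₂))]
    have h5 := hsq _ h₁
    have h6 := hsq _ h₂
    have : |t| * (β₁ ^ 2 + β₂ ^ 2) ≤ 1 * (2 * M ^ 2) :=
      mul_le_mul ht (by linarith) (by positivity) (by norm_num)
    rw [one_mul] at this
    gcongr
  have hd : |γ * (‖g₁‖ ^ 2 + ‖g₂‖ ^ 2)| ≤ M * (‖g₁‖ ^ 2 + ‖g₂‖ ^ 2) := by
    rw [abs_mul, abs_of_nonneg (add_nonneg (sq_nonneg ‖g₁‖) (sq_nonneg ‖g₂‖))]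
    gcongr
  rw [energyQuot, abs_mul]
  refine mul_le_mul ?_ hJ (abs_nonneg _) (by positivity)
  refine (abs_sub _ _).trans ?_
  have h7 := abs_add_le (2 * β₁ * inner ℝ g₁ h + 2 * β₂ * inner ℝ g₂ h)
    (t * (β₁ ^ 2 + β₂ ^ 2) * ‖h‖ ^ 2)
  have h8 := abs_add_le (2 * β₁ * inner ℝ g₁ h) (2 * β₂ * inner ℝ g₂ h)
  have h9 := hb β₁ g₁ h₁
  have h10 := hb β₂ g₂ h₂
  linarith

/-- The energy of a domain variation, after the change of variables. -/
theorem integral_energy_comp_shear [CompleteSpace V] (hΩ : IsOpen Ω)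
    (hF₁ : HasWeakPartial Ω 1 F G₁) (hF₂ : HasWeakPartial Ω Complex.I F G₂)
    (hFa : HasWeakPartial Ω a F H) (iF : IntegrableOn F Ω) (iG₁ : IntegrableOn G₁ Ω)
    (iG₂ : IntegrableOn G₂ Ω) (iH : IntegrableOn H Ω)
    (h1 : ContDiff ℝ ∞ η) (h2 : HasCompactSupport η) (h3 : tsupport η ⊆ Ω)
    (hL : LipschitzWith L η) (ha : ‖a‖ = 1) (ht : |t| * L ≤ 1 / 2) {Y : ℂ → ℂ}
    (hl : Function.LeftInverse Y (shear η a t)) (hr : Function.RightInverse Y (shear η a t)) :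
    ∫ z in Ω, (‖weakPartial Ω 1 (fun x => F (shear η a t x)) z‖ ^ 2
        + ‖weakPartial Ω Complex.I (fun x => F (shear η a t x)) z‖ ^ 2)
      = ∫ y in Ω, (‖G₁ y‖ ^ 2 + ‖G₂ y‖ ^ 2 + t * energyQuot t (fderiv ℝ η (Y y) 1)
          (fderiv ℝ η (Y y) Complex.I) (fderiv ℝ η (Y y) a) (G₁ y) (G₂ y) (H y)) := by
  have w₁ := (hF₁.comp_shear hΩ hFa iF iG₁ iH h1 h2 h3 hL ha ht).weakPartial_ae_eq hΩ
  have w₂ := (hF₂.comp_shear hΩ hFa iF iG₂ iH h1 h2 h3 hL ha ht).weakPartial_ae_eq hΩ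
  have himg : shear η a t '' Ω = Ω := by
    ext y
    constructor
    · rintro ⟨z, hz, rfl⟩
      exact (shear_mem_iff hl.injective h3).2 hz
    · intro hy
      refine ⟨Y y, ?_, hr y⟩
      rw [← shear_mem_iff hl.injective h3, hr y]
      exact hy
  -- Substitution `y = shear η a t z`, which maps `Ω` onto itself. The Jacobian cancels the factor
  -- `(1 + t * γ)⁻¹` built into `energyQuot`.
  have hcv := integral_image_eq_integral_abs_det_fderiv_smul volume hΩ.measurableSet
    (fun x _ => (hasFDerivAt_shear h1 a t x).hasFDerivWithinAt) hl.injective.injOn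
    (fun y => ‖G₁ y‖ ^ 2 + ‖G₂ y‖ ^ 2 + t * energyQuot t (fderiv ℝ η (Y y) 1)
          (fderiv ℝ η (Y y) Complex.I) (fderiv ℝ η (Y y) a) (G₁ y) (G₂ y) (H y))
  rw [himg] at hcv
  rw [hcv]
  refine integral_congr_ae ?_
  filter_upwards [w₁, w₂] with z z₁ z₂
  have hdet := half_le_det hL ha ht z
  have hpos : 0 < 1 + t * fderiv ℝ η z a := by
    rw [← det_shearDeriv]
    linarith
  rw [z₁, z₂, hl z, ← energy_eq_add_mul_energyQuot hpos.ne', det_shearDeriv, abs_of_pos hpos,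
    smul_eq_mul]
  field_simp

theorem tendsto_shear_inverse (h1 : Continuous η) (h2 : HasCompactSupport η) {Y : ℝ → ℂ → ℂ}
    (hr : ∀ᶠ t in 𝓝[≠] 0, Function.RightInverse (Y t) (shear η a t)) (y : ℂ) :
    Tendsto (fun t => Y t y) (𝓝[≠] 0) (𝓝 y) := by
  obtain ⟨M, hM⟩ := h1.bounded_above_of_compact_support h2
  rw [tendsto_iff_norm_sub_tendsto_zero]
  have h0 : Tendsto (fun t : ℝ => |t| * (M * ‖a‖)) (𝓝[≠] 0) (𝓝 0) :=
    (Continuous.tendsto' (by fun_prop) _ _ (by simp)).mono_left nhdsWithin_le_nhds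
  refine squeeze_zero' (Eventually.of_forall fun _ => norm_nonneg _) ?_ h0
  filter_upwards [hr] with t ht
  have h4 := ht y
  have h5 : Y t y - y = - (t • (η (Y t y) • a)) := by
    rw [eq_neg_iff_add_eq_zero, sub_add_eq_add_sub, sub_eq_zero]
    exact h4
  rw [h5, norm_neg, norm_smul, norm_smul, Real.norm_eq_abs]
  gcongr
  exact hM _

omit [InnerProductSpace ℝ V] in
theorem integrable_energyBound (hG₁ : MemLp G₁ 2 (volume.restrict Ω))
    (hG₂ : MemLp G₂ 2 (volume.restrict Ω)) (hH : MemLp H 2 (volume.restrict Ω)) (M : ℝ) :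
    Integrable (fun y => (2 * M * (‖G₁ y‖ ^ 2 + ‖G₂ y‖ ^ 2 + ‖H y‖ ^ 2)
      + 2 * M ^ 2 * ‖H y‖ ^ 2) * 2) (volume.restrict Ω) := by
  have n1 := hG₁.integrable_norm_pow (by norm_num)
  have n2 := hG₂.integrable_norm_pow (by norm_num)
  have n3 := hH.integrable_norm_pow (by norm_num)
  exact ((((n1.add n2).add n3).const_mul _).add (n3.const_mul _)).mul_const _

theorem integrable_energyQuot (hG₁ : MemLp G₁ 2 (volume.restrict Ω))
    (hG₂ : MemLp G₂ 2 (volume.restrict Ω)) (hH : MemLp H 2 (volume.restrict Ω))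
    {β₁ β₂ γ : ℂ → ℝ} (hβ₁ : Continuous β₁) (hβ₂ : Continuous β₂) (hγ : Continuous γ) {M : ℝ}
    (b₁ : ∀ y, |β₁ y| ≤ M) (b₂ : ∀ y, |β₂ y| ≤ M) (b₃ : ∀ y, |γ y| ≤ M) (ht : |t| ≤ 1)
    (h0 : ∀ y, 1 / 2 ≤ 1 + t * γ y) :
    Integrable (fun y => energyQuot t (β₁ y) (β₂ y) (γ y) (G₁ y) (G₂ y) (H y))
      (volume.restrict Ω) := by
  refine (integrable_energyBound hG₁ hG₂ hH M).mono' ?_ (Eventually.of_forall fun y =>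
    abs_energyQuot_le ht (h0 y) (b₁ y) (b₂ y) (b₃ y) _ _ _)
  have m1 := hβ₁.aemeasurable (μ := volume.restrict Ω)
  have m2 := hβ₂.aemeasurable (μ := volume.restrict Ω)
  have m3 := hγ.aemeasurable (μ := volume.restrict Ω)
  have i1 := (hG₁.1.inner (𝕜 := ℝ) hH.1).aemeasurable
  have i2 := (hG₂.1.inner (𝕜 := ℝ) hH.1).aemeasurable
  have n1 := hG₁.1.norm.aemeasurable
  have n2 := hG₂.1.norm.aemeasurable
  have n3 := hH.1.norm.aemeasurable
  unfold energyQuot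
  exact AEMeasurable.aestronglyMeasurable (by fun_prop)

theorem abs_fderiv_apply_le (hL : LipschitzWith L η) {v : ℂ} (hv : ‖v‖ = 1) (z : ℂ) :
    |fderiv ℝ η z v| ≤ L := by
  have h := (fderiv ℝ η z).le_opNorm v
  rw [hv, mul_one] at h
  exact h.trans (norm_fderiv_le_of_lipschitz ℝ hL)

/-- After the change of variables the weak derivatives are evaluated at a fixed point, and `t`
enters only through continuous coefficients at `Y t y`, which tends to `y`. Dominated convergence
therefore applies although the derivatives are only in `L²`. -/
theorem tendsto_integral_energyQuot (hG₁ : MemLp G₁ 2 (volume.restrict Ω))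
    (hG₂ : MemLp G₂ 2 (volume.restrict Ω)) (hH : MemLp H 2 (volume.restrict Ω))
    (h1 : ContDiff ℝ ∞ η) (h2 : HasCompactSupport η) (hL : LipschitzWith L η) (ha : ‖a‖ = 1)
    {Y : ℝ → ℂ → ℂ} (hY : ∀ᶠ t in 𝓝[≠] 0, Continuous (Y t))
    (hr : ∀ᶠ t in 𝓝[≠] 0, Function.RightInverse (Y t) (shear η a t))
    (hs : ∀ᶠ t : ℝ in 𝓝[≠] 0, |t| * L ≤ 1 / 2) :
    (∀ᶠ t in 𝓝[≠] 0, Integrable (fun y => energyQuot t (fderiv ℝ η (Y t y) 1)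
      (fderiv ℝ η (Y t y) Complex.I) (fderiv ℝ η (Y t y) a) (G₁ y) (G₂ y) (H y))
      (volume.restrict Ω)) ∧
    Tendsto (fun t => ∫ y in Ω, energyQuot t (fderiv ℝ η (Y t y) 1)
      (fderiv ℝ η (Y t y) Complex.I) (fderiv ℝ η (Y t y) a) (G₁ y) (G₂ y) (H y)) (𝓝[≠] 0)
      (𝓝 (∫ y in Ω, energyQuot 0 (fderiv ℝ η y 1)
        (fderiv ℝ η y Complex.I) (fderiv ℝ η y a) (G₁ y) (G₂ y) (H y))) := by
  have ht1 : ∀ᶠ t : ℝ in 𝓝[≠] 0, |t| ≤ 1 := by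
    have : Tendsto (fun t : ℝ => |t|) (𝓝[≠] 0) (𝓝 0) :=
      (Continuous.tendsto' (by fun_prop) _ _ (by simp)).mono_left nhdsWithin_le_nhds
    filter_upwards [this.eventually (gt_mem_nhds one_pos)] with t ht using ht.le
  have hmeas : ∀ᶠ t in 𝓝[≠] 0, Integrable (fun y => energyQuot t (fderiv ℝ η (Y t y) 1)
      (fderiv ℝ η (Y t y) Complex.I) (fderiv ℝ η (Y t y) a) (G₁ y) (G₂ y) (H y))
      (volume.restrict Ω) := by
    filter_upwards [hY, ht1, hs] with t hY ht hst
    have hb : ∀ v : ℂ, Continuous (fun y => fderiv ℝ η (Y t y) v) := fun v =>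
      (continuous_fderiv_apply h1 v).comp hY
    refine integrable_energyQuot hG₁ hG₂ hH (hb _) (hb _) (hb _)
      (fun _ => abs_fderiv_apply_le hL (by simp) _) (fun _ => abs_fderiv_apply_le hL (by simp) _)
      (fun _ => abs_fderiv_apply_le hL ha _) ht fun y => ?_
    rw [← det_shearDeriv]
    exact half_le_det hL ha hst _
  have hbound : ∀ᶠ t in 𝓝[≠] 0, ∀ y, ‖energyQuot t (fderiv ℝ η (Y t y) 1)
      (fderiv ℝ η (Y t y) Complex.I) (fderiv ℝ η (Y t y) a) (G₁ y) (G₂ y) (H y)‖ ≤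
      (2 * L * (‖G₁ y‖ ^ 2 + ‖G₂ y‖ ^ 2 + ‖H y‖ ^ 2) + 2 * (L : ℝ) ^ 2 * ‖H y‖ ^ 2) * 2 := by
    filter_upwards [ht1, hs] with t ht hst y
    refine abs_energyQuot_le ht ?_ (abs_fderiv_apply_le hL (by simp) _)
      (abs_fderiv_apply_le hL (by simp) _) (abs_fderiv_apply_le hL ha _) _ _ _
    rw [← det_shearDeriv]
    exact half_le_det hL ha hst _
  refine ⟨hmeas, tendsto_integral_filter_of_dominated_convergence _
    (hmeas.mono fun t ht => ht.aestronglyMeasurable) ?_ (integrable_energyBound hG₁ hG₂ hH L) ?_⟩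
  · filter_upwards [hbound] with t hb using Eventually.of_forall hb
  · refine Eventually.of_forall fun y => ?_
    have hYy := tendsto_shear_inverse h1.continuous h2 hr y
    have hb : ∀ v : ℂ, Tendsto (fun t => fderiv ℝ η (Y t y) v) (𝓝[≠] 0) (𝓝 (fderiv ℝ η y v)) :=
      fun v => ((continuous_fderiv_apply h1 v).tendsto y).comp hYy
    have htt : Tendsto (fun t : ℝ => t) (𝓝[≠] 0) (𝓝 0) := nhdsWithin_le_nhds
    unfold energyQuot
    refine Tendsto.mul ?_ (Tendsto.inv₀ ((htt.mul (hb a)).const_add 1) (by simp))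
    exact ((((hb 1).const_mul 2).mul_const _).add (((hb _).const_mul 2).mul_const _)).add
      ((htt.mul (((hb 1).pow 2).add ((hb _).pow 2))).mul_const _) |>.sub ((hb a).mul_const _)

end EnergyVariation

/-! ### The distributional Cauchy–Riemann equation -/

section NoetherEquation
open scoped NNReal
variable {n Q : ℕ} {Ω : Set ℂ} {f : ℂ → QSpace n Q}

/-- The first variation of the Dirichlet integral in the direction `a` with profile `η`. -/
theorem WeaklyNoetherHarmonic.integral_energyQuot_eq_zero (hf : WeaklyNoetherHarmonic Ω f)
    (hΩ : IsOpen Ω) (hfin : IsFiniteMeasure (volume.restrict Ω))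
    (hF : MemW12 Ω fun z => xi0 (stdFrame n) (f z)) {a : ℂ} (ha : a = 1 ∨ a = Complex.I)
    {η : ℂ → ℝ} (h1 : ContDiff ℝ ∞ η) (h2 : HasCompactSupport η) (h3 : tsupport η ⊆ Ω) :
    ∫ y in Ω, energyQuot 0 (fderiv ℝ η y 1) (fderiv ℝ η y Complex.I) (fderiv ℝ η y a)
      (weakPartial Ω 1 (fun z => xi0 (stdFrame n) (f z)) y)
      (weakPartial Ω Complex.I (fun z => xi0 (stdFrame n) (f z)) y)
      (weakPartial Ω a (fun z => xi0 (stdFrame n) (f z)) y) = 0 := by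
  obtain ⟨L, hL⟩ := h1.lipschitzWith_of_hasCompactSupport h2 (by simp)
  have ha1 : ‖a‖ = 1 := by rcases ha with rfl | rfl <;> simp
  set F := fun z => xi0 (stdFrame n) (f z)
  have m1 := hF.memLp_weakPartial hΩ (Or.inl rfl)
  have m2 := hF.memLp_weakPartial hΩ (Or.inr rfl)
  have m3 := hF.memLp_weakPartial hΩ ha
  have hint : ∀ {G : ℂ → EuclideanSpace ℝ (Fin n × Fin Q)}, MemLp G 2 (volume.restrict Ω) →
      IntegrableOn G Ω := fun h => h.integrable (by norm_num)
  have hs : ∀ᶠ t : ℝ in 𝓝[≠] 0, |t| * L ≤ 1 / 2 := by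
    have : Tendsto (fun t : ℝ => |t| * L) (𝓝[≠] 0) (𝓝 0) :=
      (Continuous.tendsto' (by fun_prop) _ _ (by simp)).mono_left nhdsWithin_le_nhds
    filter_upwards [this.eventually (gt_mem_nhds one_half_pos)] with t ht using ht.le
  have hex : ∀ t : ℝ, |t| * L ≤ 1 / 2 → ∃ Y : ℂ → ℂ, Continuous Y ∧
      Function.LeftInverse Y (shear η a t) ∧ Function.RightInverse Y (shear η a t) :=
    fun t ht => exists_shear_inverse hL ha1 ht
  choose! Y hYc hYl hYr using hex
  obtain ⟨hi, hlim⟩ := tendsto_integral_energyQuot m1 m2 m3 h1 h2 hL ha1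
    (hs.mono fun t ht => hYc t ht) (hs.mono fun t ht => hYr t ht) hs
  refine tendsto_nhds_unique hlim ?_
  have hvar := hf (fun z => η z • a) (h1.smul contDiff_const) h2.smul_right
    ((tsupport_smul_subset_left _ _).trans h3)
  refine hvar.congr' ?_
  filter_upwards [hs, hi, self_mem_nhdsWithin] with t ht hit ht0
  have ht0 : t ≠ 0 := ht0
  have e1 := integral_energy_comp_shear hΩ (hF.exists_hasWeakPartial (Or.inl rfl))
    (hF.exists_hasWeakPartial (Or.inr rfl)) (hF.exists_hasWeakPartial ha) (hint hF.1) (hint m1)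
    (hint m2) (hint m3) h1 h2 h3 hL ha1 ht (hYl t ht) (hYr t ht)
  have e2 : Dir Ω (fun x => f (x + t • (η x • a)))
      = ∫ z in Ω, (‖weakPartial Ω 1 (fun x => F (shear η a t x)) z‖ ^ 2
        + ‖weakPartial Ω Complex.I (fun x => F (shear η a t x)) z‖ ^ 2) := rfl
  have e3 : Dir Ω f = ∫ z in Ω, (‖weakPartial Ω 1 F z‖ ^ 2 + ‖weakPartial Ω Complex.I F z‖ ^ 2) := rfl
  have n12 : Integrable (fun y => ‖weakPartial Ω 1 F y‖ ^ 2 + ‖weakPartial Ω Complex.I F y‖ ^ 2)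
      (volume.restrict Ω) :=
    (m1.integrable_norm_pow (by norm_num)).add (m2.integrable_norm_pow (by norm_num))
  rw [e2, e1, e3, integral_add n12 (hit.const_mul t), integral_const_mul,
    add_sub_cancel_left, mul_div_cancel_left₀ _ ht0]

/-- The Hopf differential is antiholomorphically closed in the sense of distributions. -/
theorem WeaklyNoetherHarmonic.integral_hopf_eq_zero (hf : WeaklyNoetherHarmonic Ω f)
    (hΩ : IsOpen Ω) (hfin : IsFiniteMeasure (volume.restrict Ω))
    (hF : MemW12 Ω fun z => xi0 (stdFrame n) (f z))
    {η : ℂ → ℝ} (h1 : ContDiff ℝ ∞ η) (h2 : HasCompactSupport η) (h3 : tsupport η ⊆ Ω) :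
    ∫ z in Ω, ((fderiv ℝ η z 1 : ℂ) + Complex.I * (fderiv ℝ η z Complex.I : ℂ))
      * hopf Ω (fun z => xi0 (stdFrame n) (f z)) z = 0 := by
  obtain ⟨L, hL⟩ := h1.lipschitzWith_of_hasCompactSupport h2 (by simp)
  have m1 := hF.memLp_weakPartial hΩ (Or.inl rfl)
  have m2 := hF.memLp_weakPartial hΩ (Or.inr rfl)
  have e1 := hf.integral_energyQuot_eq_zero hΩ hfin hF (Or.inl rfl) h1 h2 h3
  have e2 := hf.integral_energyQuot_eq_zero hΩ hfin hF (Or.inr rfl) h1 h2 h3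
  have c1 := continuous_fderiv_apply h1 1
  have c2 := continuous_fderiv_apply h1 Complex.I
  have b1 := abs_fderiv_apply_le hL (v := 1) (by simp)
  have b2 := abs_fderiv_apply_le hL (v := Complex.I) (by simp)
  have i1 := integrable_energyQuot (t := 0) m1 m2 m1 c1 c2 c1 b1 b2 b1 (by simp)
    (fun _ => by norm_num)
  have i2 := integrable_energyQuot (t := 0) m1 m2 m2 c1 c2 c2 b1 b2 b2 (by simp)
    (fun _ => by norm_num)
  have i1' := i1.ofReal (𝕜 := ℂ)
  have i2' := (i2.ofReal (𝕜 := ℂ)).const_mul Complex.I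
  -- The equation for `a = 1` minus `I` times that for `a = I`: the two real integrands combine to
  -- `(η_u + i η_v)` times the Hopf coefficient.
  have e3 := integral_sub i1' i2'
  rw [integral_const_mul, integral_ofReal, integral_ofReal, e1, e2] at e3
  simp only [RCLike.ofReal_zero, mul_zero, sub_zero] at e3
  rw [← e3]
  refine integral_congr_ae (Eventually.of_forall fun z => ?_)
  simp only [hopf, energyQuot, real_inner_self_eq_norm_sq, RCLike.ofReal_eq_complex_ofReal]
  rw [real_inner_comm (weakPartial Ω 1 _ z) (weakPartial Ω Complex.I _ z)]
  push_cast
  ring_nf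
  simp only [Complex.I_sq]
  ring

end NoetherEquation
end QVal

namespace QVal

/-! ### Weyl's lemma for the Cauchy–Riemann operator -/

section Weyl
open scoped ENNReal
variable {Ω : Set ℂ} {φ g : ℂ → ℂ}

/-- The mean value property on a circle, as an estimate. -/
theorem enorm_le_lintegral_circle {z : ℂ} {ρ : ℝ} (hρ : 0 < ρ)
    (hd : ∀ w ∈ closedBall z ρ, DifferentiableAt ℂ g w) :
    ENNReal.ofReal (2 * Real.pi) * ‖g z‖ₑ ≤
      ∫⁻ θ in Set.Ioo (-Real.pi) Real.pi, ‖g (circleMap z ρ θ)‖ₑ := by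
  have hdc : DiffContOnCl ℂ g (ball z |ρ|) := by
    rw [abs_of_pos hρ]
    refine DifferentiableOn.diffContOnCl ?_
    rw [closure_ball z hρ.ne']
    exact fun w hw => (hd w hw).differentiableWithinAt
  have h1 := hdc.circleAverage
  rw [Real.circleAverage_eq_integral_add (-Real.pi),
    intervalIntegral.integral_comp_add_right (fun θ => g (circleMap z ρ θ))] at h1
  have e : 2 * Real.pi + -Real.pi = Real.pi := by ring
  rw [zero_add, e, intervalIntegral.integral_of_le (by linarith [Real.pi_pos]),
    integral_Ioc_eq_integral_Ioo] at h1
  have h2 : (2 * Real.pi) • g z = ∫ θ in Set.Ioo (-Real.pi) Real.pi, g (circleMap z ρ θ) := by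
    rw [← h1, smul_smul, mul_inv_cancel₀ (by positivity), one_smul]
  calc ENNReal.ofReal (2 * Real.pi) * ‖g z‖ₑ = ‖(2 * Real.pi) • g z‖ₑ := by
        rw [enorm_smul, Real.enorm_of_nonneg (by positivity)]
    _ ≤ _ := by
        rw [h2]
        exact enorm_integral_le_lintegral_enorm _

/-- A holomorphic function is bounded by its `L¹` norm. -/
theorem enorm_le_lintegral_of_differentiableAt (hc : Continuous g) {z : ℂ} {r : ℝ} (hr : 0 < r)
    (hd : ∀ w ∈ closedBall z r, DifferentiableAt ℂ g w) :
    ENNReal.ofReal (r / 2) * ENNReal.ofReal (r / 2) * ENNReal.ofReal (2 * Real.pi) * ‖g z‖ₑ ≤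
      ∫⁻ w, ‖g w‖ₑ := by
  have hpol : ∀ p : ℝ × ℝ, z + Complex.polarCoord.symm p = circleMap z p.1 p.2 := fun p => by
    rw [Complex.polarCoord_symm_apply, circleMap, Complex.exp_mul_I]
    push_cast
    rfl
  -- Only the annulus of radii between `r / 2` and `r` is used, where the polar weight `ρ` is at
  -- least `r / 2`. This produces the constant.
  have hsub : Set.Ioo (r / 2) r ×ˢ Set.Ioo (-Real.pi) Real.pi ⊆ polarCoord.target := by
    rintro ⟨ρ, θ⟩ ⟨h1, h2⟩
    exact ⟨lt_trans (half_pos hr) h1.1, h2⟩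
  calc ENNReal.ofReal (r / 2) * ENNReal.ofReal (r / 2) * ENNReal.ofReal (2 * Real.pi) * ‖g z‖ₑ
      = ∫⁻ ρ in Set.Ioo (r / 2) r,
          ENNReal.ofReal (r / 2) * (ENNReal.ofReal (2 * Real.pi) * ‖g z‖ₑ) := by
        rw [setLIntegral_const, Real.volume_Ioo, sub_half]
        ring
    _ ≤ ∫⁻ ρ in Set.Ioo (r / 2) r, ∫⁻ θ in Set.Ioo (-Real.pi) Real.pi,
          ENNReal.ofReal ρ * ‖g (circleMap z ρ θ)‖ₑ := by
        refine setLIntegral_mono' measurableSet_Ioo fun ρ hρ => ?_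
        rw [lintegral_const_mul' _ _ ENNReal.ofReal_ne_top]
        refine mul_le_mul' (ENNReal.ofReal_le_ofReal hρ.1.le) (enorm_le_lintegral_circle
          (lt_trans (half_pos hr) hρ.1) fun w hw => hd w (closedBall_subset_closedBall hρ.2.le hw))
    _ = ∫⁻ p in Set.Ioo (r / 2) r ×ˢ Set.Ioo (-Real.pi) Real.pi,
          ENNReal.ofReal p.1 * ‖g (circleMap z p.1 p.2)‖ₑ := by
        rw [Measure.volume_eq_prod, ← Measure.prod_restrict, lintegral_prod]
        refine AEMeasurable.mul (ENNReal.measurable_ofReal.comp measurable_fst).aemeasurable ?_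
        refine (hc.comp ?_).measurable.enorm.aemeasurable
        unfold circleMap
        fun_prop
    _ ≤ ∫⁻ p in polarCoord.target, ENNReal.ofReal p.1 * ‖g (circleMap z p.1 p.2)‖ₑ :=
        lintegral_mono_set hsub
    _ = ∫⁻ w, ‖g (z + w)‖ₑ := by
        rw [← Complex.lintegral_comp_polarCoord_symm]
        simp only [hpol, smul_eq_mul]
    _ = ∫⁻ w, ‖g w‖ₑ := lintegral_add_left_eq_self (fun w => ‖g w‖ₑ) z

/-- Testing the weak equation with the kernel centred at `z` gives the pointwise Cauchy–Riemann
equation for the mollification. -/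
theorem differentiableAt_mollify_of_integral_eq_zero (hΩ : IsOpen Ω) (hφ : IntegrableOn φ Ω)
    (h : ∀ η : ℂ → ℝ, ContDiff ℝ ∞ η → HasCompactSupport η → tsupport η ⊆ Ω →
      ∫ z in Ω, ((fderiv ℝ η z 1 : ℂ) + Complex.I * (fderiv ℝ η z Complex.I : ℂ)) * φ z = 0)
    {k : ℕ} {z : ℂ} (hz : closedBall z (1 / (k + 1 : ℝ)) ⊆ Ω) :
    DifferentiableAt ℂ (mollify k (Ω.indicator φ)) z := by
  have hi := hφ.integrable_indicator hΩ.measurableSet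
  have hs := (tsupport_kernelAt k z).trans hz
  have hdiff := ((contDiff_mollify k hi.locallyIntegrable).differentiable (by simp)) z
  refine differentiableAt_complex_iff_differentiableAt_real.2 ⟨hdiff, ?_⟩
  have hcd := contDiff_kernelAt k z
  have hcs := hasCompactSupport_kernelAt k z
  have hint : ∀ v, Integrable fun w => fderiv ℝ (kernelAt k z) w v • Ω.indicator φ w := fun v =>
    integrable_smul_of_locallyIntegrableOn (continuous_fderiv_apply hcd v)
      (hasCompactSupport_fderiv_apply hcs v) (Set.subset_univ _)
      (hi.locallyIntegrable.locallyIntegrableOn _)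
  have h0 := h _ hcd hcs hs
  rw [← integral_indicator hΩ.measurableSet] at h0
  have e : (∫ w, fderiv ℝ (kernelAt k z) w 1 • Ω.indicator φ w)
      + Complex.I * ∫ w, fderiv ℝ (kernelAt k z) w Complex.I • Ω.indicator φ w = 0 := by
    rw [← integral_const_mul, ← integral_add (hint _) ((hint _).const_mul _), ← h0]
    refine integral_congr_ae (Eventually.of_forall fun w => ?_)
    by_cases hw : w ∈ Ω
    · simp only [Set.indicator_of_mem hw, Complex.real_smul]
      ring
    · simp [hw]
  rw [fderiv_mollify k hi.locallyIntegrable, fderiv_mollify k hi.locallyIntegrable, smul_eq_mul]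
  linear_combination Complex.I * e - (∫ w, fderiv ℝ (kernelAt k z) w Complex.I • Ω.indicator φ w) *
    Complex.I_mul_I

/-- Weyl's lemma for the Cauchy–Riemann operator. -/
theorem exists_differentiableOn_ae_eq (hΩ : IsOpen Ω) (hφ : IntegrableOn φ Ω)
    (h : ∀ η : ℂ → ℝ, ContDiff ℝ ∞ η → HasCompactSupport η → tsupport η ⊆ Ω →
      ∫ z in Ω, ((fderiv ℝ η z 1 : ℂ) + Complex.I * (fderiv ℝ η z Complex.I : ℂ)) * φ z = 0) :
    ∃ ψ : ℂ → ℂ, DifferentiableOn ℂ ψ Ω ∧ ψ =ᵐ[volume.restrict Ω] φ := by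
  set φ₀ := Ω.indicator φ
  have hi : Integrable φ₀ := hφ.integrable_indicator hΩ.measurableSet
  have hcont : ∀ k, Continuous (mollify k φ₀) := fun k =>
    (contDiff_mollify k hi.locallyIntegrable).continuous
  have hL1 := tendsto_eLpNorm_mollify_sub hi
  -- Nested radii: kernels of radius below `r` centred in the ball of radius `2 * r` stay in `Ω`,
  -- and discs of radius `r` about points of the ball of radius `r` stay where the mollifications
  -- are holomorphic.
  have hrad : ∀ z ∈ Ω, ∃ r > 0, closedBall z (3 * r) ⊆ Ω := fun z hz => by
    obtain ⟨r, hr, h'⟩ := Metric.nhds_basis_closedBall.mem_iff.1 (hΩ.mem_nhds hz)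
    exact ⟨r / 3, by positivity, by rwa [mul_div_cancel₀ _ three_ne_zero]⟩
  have hhol : ∀ (z : ℂ) (r : ℝ), 0 < r → closedBall z (3 * r) ⊆ Ω → ∀ᶠ k in atTop,
      ∀ w ∈ closedBall z (2 * r), DifferentiableAt ℂ (mollify k φ₀) w := by
    intro z r hr hz
    have hk : ∀ᶠ k : ℕ in atTop, 1 / (k + 1 : ℝ) < r :=
      (tendsto_one_div_add_atTop_nhds_zero_nat (𝕜 := ℝ)).eventually (gt_mem_nhds hr)
    filter_upwards [hk] with k hk w hw
    refine differentiableAt_mollify_of_integral_eq_zero hΩ hφ h fun x hx => hz ?_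
    rw [mem_closedBall] at hx hw ⊢
    linarith [dist_triangle x w z]
  -- Differences of mollifications are holomorphic there, so being Cauchy in `L¹` makes the sequence
  -- uniformly Cauchy.
  have hcauchy : ∀ (z : ℂ) (r : ℝ), 0 < r → closedBall z (3 * r) ⊆ Ω →
      UniformCauchySeqOn (fun k => mollify k φ₀) atTop (ball z r) := by
    intro z r hr hz
    set c := ENNReal.ofReal (r / 2) * ENNReal.ofReal (r / 2) * ENNReal.ofReal (2 * Real.pi)
    have hc0 : c ≠ 0 := by
      have := Real.pi_pos
      simp only [c, ne_eq, mul_eq_zero, ENNReal.ofReal_eq_zero, not_or, not_le]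
      refine ⟨⟨?_, ?_⟩, ?_⟩ <;> positivity
    rw [Metric.uniformCauchySeqOn_iff]
    intro ε hε
    have hpos : 0 < c * ENNReal.ofReal ε / 2 :=
      ENNReal.half_pos (mul_ne_zero hc0 (ENNReal.ofReal_pos.2 hε).ne')
    obtain ⟨N, hN⟩ := eventually_atTop.1
      ((hL1.eventually (gt_mem_nhds hpos)).and (hhol z r hr hz))
    refine ⟨N, fun k hk l hl w hw => ?_⟩
    have hd : ∀ x ∈ closedBall w r, DifferentiableAt ℂ (mollify k φ₀ - mollify l φ₀) x := by
      intro x hx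
      have hx2 : x ∈ closedBall z (2 * r) := by
        rw [mem_closedBall] at hx ⊢
        linarith [dist_triangle x w z, mem_ball.1 hw]
      exact ((hN k hk).2 x hx2).sub ((hN l hl).2 x hx2)
    have h1 := enorm_le_lintegral_of_differentiableAt ((hcont k).sub (hcont l)) hr hd
    have hm : ∀ k, AEStronglyMeasurable (fun z => mollify k φ₀ z - φ₀ z) volume := fun k =>
      (hcont k).aestronglyMeasurable.sub hi.aestronglyMeasurable
    have h2 := eLpNorm_sub_le (hm k) (hm l) (le_refl 1)
    have e : ((fun z => mollify k φ₀ z - φ₀ z) - fun z => mollify l φ₀ z - φ₀ z)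
        = mollify k φ₀ - mollify l φ₀ := by
      funext z
      simp
    rw [e, eLpNorm_one_eq_lintegral_enorm] at h2
    have h3 : c * ‖(mollify k φ₀ - mollify l φ₀) w‖ₑ < c * ENNReal.ofReal ε := by
      refine (h1.trans h2).trans_lt ?_
      rw [← ENNReal.add_halves (c * ENNReal.ofReal ε)]
      exact ENNReal.add_lt_add (hN k hk).1 (hN l hl).1
    have h4 := lt_of_mul_lt_mul_left' h3
    rw [← ofReal_norm, ENNReal.ofReal_lt_ofReal_iff hε] at h4
    rwa [dist_eq_norm]
  have hex : ∀ z ∈ Ω, ∃ y, Tendsto (fun k => mollify k φ₀ z) atTop (𝓝 y) := by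
    intro z hz
    obtain ⟨r, hr, hr'⟩ := hrad z hz
    exact cauchySeq_tendsto_of_complete ((hcauchy z r hr hr').cauchySeq (mem_ball_self hr))
  choose! ψ hψ using hex
  refine ⟨ψ, fun z hz => ?_, ?_⟩
  · obtain ⟨r, hr, hr'⟩ := hrad z hz
    have hsub : ball z r ⊆ Ω := fun w hw => hr' <| by
      rw [mem_closedBall]
      have := mem_ball.1 hw
      linarith
    have hu := (hcauchy z r hr hr').tendstoUniformlyOn_of_tendsto (f := ψ)
      fun w hw => hψ w (hsub hw)
    have hd := hu.tendstoLocallyUniformlyOn.differentiableOn ?_ isOpen_ball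
    · exact (hd.differentiableAt (ball_mem_nhds z hr)).differentiableWithinAt
    · filter_upwards [hhol z r hr hr'] with k hk w hw
      refine (hk w ?_).differentiableWithinAt
      rw [mem_closedBall]
      have := mem_ball.1 hw
      linarith
  · have hm : TendstoInMeasure volume (fun k => mollify k φ₀) atTop φ₀ :=
      tendstoInMeasure_of_tendsto_eLpNorm one_ne_zero
        (fun k => (hcont k).aestronglyMeasurable) hi.aestronglyMeasurable hL1
    obtain ⟨ns, hns, hae⟩ := hm.exists_seq_tendsto_ae
    rw [Filter.EventuallyEq, ae_restrict_iff' hΩ.measurableSet]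
    filter_upwards [hae] with z hz hzΩ
    have := tendsto_nhds_unique ((hψ z hzΩ).comp hns.tendsto_atTop) hz
    rw [this]
    exact Set.indicator_of_mem hzΩ φ

end Weyl
end QVal

namespace QVal

/-! ### Independence of the Hopf differential from the frame -/

section FrameIndependence
variable {n Q : ℕ} {Ω : Set ℂ} {f : ℂ → QSpace n Q}

/-- Retains from the correspondence its lower bound: the increments of a single Sobolev function
control `gDist`. -/
theorem MemY2.exists_memW12_gDist_le (hf : MemY2 Ω f) :
    ∃ (ι : Type) (_ : Fintype ι) (X : ℂ → EuclideanSpace ℝ ι) (c : NNReal), 0 < c ∧ MemW12 Ω X ∧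
      ∀ z w, c * gDist (f z) (f w) ≤ ‖X z - X w‖ := by
  obtain ⟨m, w, ⟨-, c, C, hc, -, hbi⟩, hX⟩ := hf
  exact ⟨_, inferInstance, _, ⟨c, hc.le⟩, hc, hX, fun z w => (hbi _ _).1⟩

/-- The coordinates of a function of the class `𝒴₂` in any frame are Sobolev functions. -/
theorem MemY2.memW12_xi0 (hf : MemY2 Ω f) (hΩ : IsOpen Ω)
    (hfin : IsFiniteMeasure (volume.restrict Ω)) (e : Frame n) :
    MemW12 Ω fun z => xi0 e (f z) := by
  obtain ⟨ι, _, X, c, hc, hX, h⟩ := hf.exists_memW12_gDist_le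
  refine memW12_of_norm_sub_le hΩ hfin hX (C := c⁻¹) fun z w => ?_
  refine (norm_xi0_sub_le_gDist e _ _).trans ?_
  rw [NNReal.coe_inv, ← div_eq_inv_mul, le_div_iff₀' (NNReal.coe_pos.2 hc)]
  exact h z w

theorem MemY2.ae_norm_eq (hf : MemY2 Ω f) (hΩ : IsOpen Ω)
    (hfin : IsFiniteMeasure (volume.restrict Ω)) (e e' : Frame n) {v : ℂ}
    {G G' : ℂ → EuclideanSpace ℝ (Fin n × Fin Q)}
    (hX : ∀ {ι : Type} [Fintype ι] {X : ℂ → EuclideanSpace ℝ ι}, MemW12 Ω X →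
      ∃ H, HasWeakPartial Ω v X H ∧ IntegrableOn H Ω)
    (hG : HasWeakPartial Ω v (fun z => xi0 e (f z)) G) (iG : IntegrableOn G Ω)
    (hG' : HasWeakPartial Ω v (fun z => xi0 e' (f z)) G') (iG' : IntegrableOn G' Ω) :
    ∀ᵐ z ∂(volume.restrict Ω), ‖G z‖ = ‖G' z‖ := by
  obtain ⟨ι, _, X, c, hc, hXW, h⟩ := hf.exists_memW12_gDist_le
  obtain ⟨H, hH, iH⟩ := hX hXW
  refine ae_norm_eq_of_norm_sub_eq hΩ hH hG hG' (hXW.1.integrable (by norm_num)) iH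
    ((hf.memW12_xi0 hΩ hfin e).1.integrable (by norm_num)) iG
    ((hf.memW12_xi0 hΩ hfin e').1.integrable (by norm_num)) iG' fun z => ?_
  obtain ⟨δ, hδ, hloc⟩ := exists_norm_xi0_sub_eq (f z) e e'
  refine ⟨c * δ, mul_pos hc hδ, fun w hw => ?_⟩
  rw [norm_sub_rev (xi0 e (f w)), norm_sub_rev (xi0 e' (f w))]
  apply hloc
  rw [norm_sub_rev] at hw
  exact lt_of_mul_lt_mul_left ((h z w).trans_lt hw) c.2

/-- The Hopf differential does not depend on the frame. -/
theorem MemY2.hopf_ae_eq (hf : MemY2 Ω f) (hΩ : IsOpen Ω)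
    (hfin : IsFiniteMeasure (volume.restrict Ω)) (e e' : Frame n) :
    hopf Ω (fun z => xi0 e (f z)) =ᵐ[volume.restrict Ω] hopf Ω (fun z => xi0 e' (f z)) := by
  have hF := hf.memW12_xi0 hΩ hfin e
  have hF' := hf.memW12_xi0 hΩ hfin e'
  have one : (1 : ℂ) = 1 ∨ (1 : ℂ) = Complex.I := Or.inl rfl
  have two : Complex.I = 1 ∨ Complex.I = Complex.I := Or.inr rfl
  have hint : ∀ {ι : Type} [Fintype ι] {X : ℂ → EuclideanSpace ℝ ι} {v : ℂ}, MemW12 Ω X →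
      (v = 1 ∨ v = Complex.I) → IntegrableOn (weakPartial Ω v X) Ω := fun hX hv =>
    (hX.memLp_weakPartial hΩ hv).integrable (by norm_num)
  have a1 := hf.ae_norm_eq hΩ hfin e e'
    (fun hX => ⟨_, hX.exists_hasWeakPartial one, hint hX one⟩)
    (hF.exists_hasWeakPartial one) (hint hF one) (hF'.exists_hasWeakPartial one) (hint hF' one)
  have a2 := hf.ae_norm_eq hΩ hfin e e'
    (fun hX => ⟨_, hX.exists_hasWeakPartial two, hint hX two⟩)
    (hF.exists_hasWeakPartial two) (hint hF two) (hF'.exists_hasWeakPartial two) (hint hF' two)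
  -- Equal lengths in the direction `1 + I`, together with those in `1` and `I`, force equal inner
  -- products of the two partial derivatives.
  have a3 := hf.ae_norm_eq hΩ hfin e e'
    (fun hX => ⟨_, (hX.exists_hasWeakPartial one).add_dir (hX.exists_hasWeakPartial two),
      (hint hX one).add (hint hX two)⟩)
    ((hF.exists_hasWeakPartial one).add_dir (hF.exists_hasWeakPartial two))
    ((hint hF one).add (hint hF two))
    ((hF'.exists_hasWeakPartial one).add_dir (hF'.exists_hasWeakPartial two))
    ((hint hF' one).add (hint hF' two))
  filter_upwards [a1, a2, a3] with z z1 z2 z3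
  have h3 := congrArg (· ^ 2) z3
  simp only [norm_add_sq_real, z1, z2] at h3
  have h4 : inner ℝ (weakPartial Ω 1 (fun z => xi0 e (f z)) z)
      (weakPartial Ω Complex.I (fun z => xi0 e (f z)) z)
      = inner ℝ (weakPartial Ω 1 (fun z => xi0 e' (f z)) z)
      (weakPartial Ω Complex.I (fun z => xi0 e' (f z)) z) := by linarith
  simp only [hopf, z1, z2, h4]

end FrameIndependence

/-! ### The harmonic companion and weak conformality -/

section ConformalExtension
variable {V : Type*} [NormedAddCommGroup V] [InnerProductSpace ℝ V] {Ω : Set ℂ}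
  {F : ℂ → V} {φ h : ℂ → ℂ}

theorem integrableOn_hopf {F : ℂ → V} (m1 : MemLp (weakPartial Ω 1 F) 2 (volume.restrict Ω))
    (m2 : MemLp (weakPartial Ω Complex.I F) 2 (volume.restrict Ω)) :
    IntegrableOn (hopf Ω F) Ω := by
  have i1 := (m1.integrable_norm_pow (by norm_num)).sub (m2.integrable_norm_pow (by norm_num))
  have i2 : Integrable (fun z => inner ℝ (weakPartial Ω 1 F z) (weakPartial Ω Complex.I F z))
      (volume.restrict Ω) := by
    refine ((m1.integrable_norm_pow (by norm_num)).add
      (m2.integrable_norm_pow (by norm_num))).mono' (m1.1.inner m2.1)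
      (Eventually.of_forall fun z => ?_)
    have := norm_inner_le_norm (𝕜 := ℝ) (weakPartial Ω 1 F z) (weakPartial Ω Complex.I F z)
    simp only [Pi.add_apply]
    nlinarith [sq_nonneg (‖weakPartial Ω 1 F z‖ - ‖weakPartial Ω Complex.I F z‖)]
  exact (i1.ofReal (𝕜 := ℂ)).sub ((i2.ofReal (𝕜 := ℂ)).const_mul (2 * Complex.I))

/-- The harmonic function with `∂_z h = -φ/4` and `∂_{z̄} h = 1`. -/
theorem exists_harmonic_of_differentiableOn {R : ℝ} (hφ : DifferentiableOn ℂ φ (ball 0 R)) :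
    ∃ h : ℂ → ℂ, InnerProductSpace.HarmonicOnNhd h (ball 0 R) ∧ ContDiffOn ℝ 1 h (ball 0 R) ∧
      ∀ z ∈ ball (0 : ℂ) R, fderiv ℝ h z 1 = (-1 / 4) * φ z + 1 ∧
        fderiv ℝ h z Complex.I = Complex.I * ((-1 / 4) * φ z - 1) := by
  -- A holomorphic primitive of `-φ/4`, which exists on the disc. Adding `z̄` makes the derivative
  -- in `z̄` equal to `1` and leaves the derivative in `z` unchanged.
  obtain ⟨H, hH⟩ := (hφ.const_mul (-1 / 4)).isExactOn_ball
  have hHd : DifferentiableOn ℂ H (ball 0 R) := fun z hz =>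
    (hH z hz).differentiableAt.differentiableWithinAt
  have hHa : ∀ z ∈ ball (0 : ℂ) R, AnalyticAt ℂ H z := fun z hz =>
    hHd.analyticAt (isOpen_ball.mem_nhds hz)
  have hharm : InnerProductSpace.HarmonicOnNhd (fun z => H z + (starRingEnd ℂ) z) (ball 0 R) :=
    fun z hz => (hHa z hz).harmonicAt.add (analyticAt_id (𝕜 := ℂ)).harmonicAt_conj
  refine ⟨_, hharm, hharm.contDiffOn.of_le (by norm_num), fun z hz => ?_⟩
  have hd : HasFDerivAt (fun z => H z + (starRingEnd ℂ) z) _ z :=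
    ((hH z hz).hasFDerivAt.restrictScalars ℝ).add Complex.conjCLE.hasFDerivAt
  rw [hd.fderiv]
  constructor
  · simp
  · simp
    ring

/-- The inclusion of the first factor of an `L²` product. -/
noncomputable def inlLp (V : Type*) [NormedAddCommGroup V] [InnerProductSpace ℝ V] :
    V →L[ℝ] WithLp 2 (V × ℂ) :=
  (WithLp.prodContinuousLinearEquiv 2 ℝ V ℂ).symm.toContinuousLinearMap.comp
    (ContinuousLinearMap.inl ℝ V ℂ)

/-- The inclusion of the second factor of an `L²` product. -/
noncomputable def inrLp (V : Type*) [NormedAddCommGroup V] [InnerProductSpace ℝ V] :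
    ℂ →L[ℝ] WithLp 2 (V × ℂ) :=
  (WithLp.prodContinuousLinearEquiv 2 ℝ V ℂ).symm.toContinuousLinearMap.comp
    (ContinuousLinearMap.inr ℝ V ℂ)

theorem inlLp_add_inrLp (x : V) (y : ℂ) : inlLp V x + inrLp V y = WithLp.toLp 2 (x, y) := by
  have h1 : inlLp V x = WithLp.toLp 2 (x, 0) := rfl
  have h2 : inrLp V y = WithLp.toLp 2 (0, y) := rfl
  rw [h1, h2, ← WithLp.toLp_add, Prod.mk_add_mk, add_zero, zero_add]

theorem hasWeakPartial_prod [CompleteSpace V] {G : ℂ → V} {g : ℂ → ℂ} {v : ℂ}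
    (hF : HasWeakPartial Ω v F G) (hh : HasWeakPartial Ω v h g) :
    HasWeakPartial Ω v (fun z => WithLp.toLp 2 (F z, h z)) (fun z => WithLp.toLp 2 (G z, g z)) := by
  simpa only [inlLp_add_inrLp] using (hF.clm_comp (inlLp V)).add (hh.clm_comp (inrLp V))

theorem memLp_prod {U : Set ℂ} {G : ℂ → V} {g : ℂ → ℂ}
    (hG : MemLp G 2 (volume.restrict U)) (hg : MemLp g 2 (volume.restrict U)) :
    MemLp (fun z => WithLp.toLp 2 (G z, g z)) 2 (volume.restrict U) := by
  have e : (fun z => WithLp.toLp 2 (G z, g z))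
      = (fun z => inlLp V (G z)) + fun z => inrLp V (g z) := by
    funext z
    exact (inlLp_add_inrLp _ _).symm
  rw [e]
  exact ((inlLp V).comp_memLp' hG).add ((inrLp V).comp_memLp' hg)

theorem memLp_of_continuousOn {U : Set ℂ} {W : Type*} [NormedAddCommGroup W] {g : ℂ → W}
    (hg : ContinuousOn g Ω) (hU : IsOpen U) (hc : IsCompact (closure U)) (hUΩ : closure U ⊆ Ω) :
    MemLp g 2 (volume.restrict U) := by
  obtain ⟨C, hC⟩ := hc.exists_bound_of_continuousOn (hg.mono hUΩ)
  have : IsFiniteMeasure (volume.restrict U) :=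
    ⟨by rw [Measure.restrict_apply_univ]; exact (measure_mono subset_closure).trans_lt hc.measure_lt_top⟩
  refine MemLp.of_bound ((hg.mono (subset_closure.trans hUΩ)).aestronglyMeasurable hU.measurableSet)
    C ?_
  filter_upwards [ae_restrict_mem hU.measurableSet] with z hz using hC z (subset_closure hz)

/-- Only local membership is claimed, since a `C¹` function `h` and its derivatives need not be
square integrable up to the boundary. -/
theorem memW12Loc_prod [CompleteSpace V] (hΩ : IsOpen Ω) (hF : MemW12 Ω F)
    (hh : ContDiffOn ℝ 1 h Ω) : MemW12Loc Ω (fun z => WithLp.toLp 2 (F z, h z)) := by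
  intro U hU hc hUΩ
  have hsub := subset_closure.trans hUΩ
  have hFU := hF.mono hsub
  refine ⟨memLp_prod hFU.1 (memLp_of_continuousOn hh.continuousOn hU hc hUΩ), fun v hv => ?_⟩
  obtain ⟨G, hG, hG2⟩ := hFU.2 v hv
  refine ⟨_, hasWeakPartial_prod hG ((hasWeakPartial_of_contDiffOn hΩ hh v).mono hsub),
    memLp_prod hG2 (memLp_of_continuousOn ?_ hU hc hUΩ)⟩
  exact (hh.continuousOn_fderiv_of_isOpen hΩ le_rfl).clm_apply continuousOn_const

/-- In an orthogonal product Hopf differentials add. With `b = -φ/4`, `h_u = b + 1` and `h_v = I *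
(b - 1)`, that of `h` is `|b + 1|² - |b - 1|² + 4 i Im b = 4 b = -φ`. -/
theorem weaklyConformal_prod [CompleteSpace V] (hΩ : IsOpen Ω) (hF : MemW12 Ω F)
    (hφ : φ =ᵐ[volume.restrict Ω] hopf Ω F) (hh : ContDiffOn ℝ 1 h Ω)
    (hd : ∀ z ∈ Ω, fderiv ℝ h z 1 = (-1 / 4) * φ z + 1 ∧
        fderiv ℝ h z Complex.I = Complex.I * ((-1 / 4) * φ z - 1)) :
    WeaklyConformal Ω (fun z => WithLp.toLp 2 (F z, h z)) := by
  have w1 := (hasWeakPartial_prod (hF.exists_hasWeakPartial (Or.inl rfl))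
    (hasWeakPartial_of_contDiffOn hΩ hh 1)).weakPartial_ae_eq hΩ
  have w2 := (hasWeakPartial_prod (hF.exists_hasWeakPartial (Or.inr rfl))
    (hasWeakPartial_of_contDiffOn hΩ hh Complex.I)).weakPartial_ae_eq hΩ
  filter_upwards [w1, w2, hφ, ae_restrict_mem hΩ.measurableSet] with z z1 z2 hz hzΩ
  obtain ⟨d1, d2⟩ := hd z hzΩ
  obtain ⟨b, hb⟩ : ∃ b, b = (-1 / 4) * φ z := ⟨_, rfl⟩
  rw [← hb] at d1 d2
  rw [hz, hopf] at hb
  have hq : (-1 / 4 : ℂ) = ((-1 / 4 : ℝ) : ℂ) := by push_cast; rfl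
  have hre := congrArg Complex.re hb
  have him := congrArg Complex.im hb
  rw [hq, Complex.re_ofReal_mul] at hre
  rw [hq, Complex.im_ofReal_mul] at him
  simp only [Complex.sub_re, Complex.sub_im, Complex.ofReal_re, Complex.ofReal_im, Complex.mul_re,
    Complex.mul_im, Complex.I_re, Complex.I_im, Complex.re_ofNat, Complex.im_ofNat] at hre him
  rw [z1, z2, d1, d2, ← sq_eq_sq₀ (norm_nonneg _) (norm_nonneg _),
    WithLp.prod_norm_sq_eq_of_L2, WithLp.prod_norm_sq_eq_of_L2, WithLp.prod_inner_apply]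
  simp only [WithLp.toLp_fst, WithLp.toLp_snd, ← Complex.normSq_eq_norm_sq, Complex.normSq_apply,
    Complex.inner, Complex.add_re, Complex.add_im, Complex.sub_re, Complex.sub_im, Complex.mul_re,
    Complex.mul_im, Complex.I_re, Complex.I_im, Complex.one_re, Complex.one_im, map_add, map_one,
    Complex.conj_re, Complex.conj_im]
  constructor <;> linarith

end ConformalExtension

/-! ### Holomorphy in all frames and the theorem -/

section Main
variable {n Q : ℕ} {Ω : Set ℂ} {f : ℂ → QSpace n Q}

/-- The Hopf differential of a weakly Noether harmonic function is holomorphic, and it is the same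
in all frames. -/
theorem WeaklyNoetherHarmonic.exists_differentiableOn_ae_eq_hopf (hY : MemY2 Ω f)
    (hf : WeaklyNoetherHarmonic Ω f) (hΩ : IsOpen Ω) (hfin : IsFiniteMeasure (volume.restrict Ω)) :
    ∃ φ : ℂ → ℂ, DifferentiableOn ℂ φ Ω ∧
      ∀ e : Frame n, φ =ᵐ[volume.restrict Ω] hopf Ω (fun z => xi0 e (f z)) := by
  have hF := hY.memW12_xi0 hΩ hfin (stdFrame n)
  obtain ⟨φ, hφ, hae⟩ := exists_differentiableOn_ae_eq hΩ
    (integrableOn_hopf (hF.memLp_weakPartial hΩ (Or.inl rfl))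
      (hF.memLp_weakPartial hΩ (Or.inr rfl)))
    (fun η h1 h2 h3 => hf.integral_hopf_eq_zero hΩ hfin hF h1 h2 h3)
  exact ⟨φ, hφ, fun e => hae.trans (hY.hopf_ae_eq hΩ hfin _ e)⟩

theorem Dir_nonneg (Ω : Set ℂ) (f : ℂ → QSpace n Q) : 0 ≤ Dir Ω f :=
  integral_nonneg fun _ => by positivity

end Main
end QVal

theorem mainTheorem3 (n Q : ℕ) (hQ : 0 < Q) :
    ∃ C : QVal.Frame n → QVal.Frame n → ℝ,
      ∀ (R₀ : ℝ), 0 < R₀ → ∀ f : ℂ → QVal.QSpace n Q,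
        QVal.WeaklyStationaryHarmonic (ball 0 R₀) f →
        ∃ φ : QVal.Frame n → ℂ → ℂ,
          (∀ e : QVal.Frame n,
            -- the Hopf differential is holomorphic
            (QVal.MemW12 (ball 0 R₀) (fun z => QVal.xi0 e (f z)) ∧
              DifferentiableOn ℂ (φ e) (ball 0 R₀) ∧
              φ e =ᵐ[volume.restrict (ball 0 R₀)]
                QVal.hopf (ball 0 R₀) (fun z => QVal.xi0 e (f z))) ∧
            -- the induced harmonic function
            ∃ h : ℂ → ℂ, InnerProductSpace.HarmonicOnNhd h (ball 0 R₀) ∧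
              (∀ z ∈ ball (0 : ℂ) R₀,
                QVal.dz h z = (-1 / 4) * φ e z ∧ QVal.dzbar h z = 1) ∧
              QVal.MemW12Loc (ball 0 R₀)
                (fun z => WithLp.toLp 2 (QVal.xi0 e (f z), h z)) ∧
              QVal.WeaklyConformal (ball 0 R₀)
                (fun z => WithLp.toLp 2 (QVal.xi0 e (f z), h z))) ∧
          -- comparison of two choices of coordinates
          ∀ e e' : QVal.Frame n,
            (∀ z ∈ ball (0 : ℂ) R₀,
              ‖φ e z - φ e' z‖ = |(φ e z).im - (φ e' z).im| ∧
              ‖φ e z - φ e' z‖ = C e e') ∧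
            C e e' ≤ 4 / (Real.pi * R₀ ^ 2) * QVal.Dir (ball 0 R₀) f := by
  -- One holomorphic function represents the Hopf differential in every frame, so the differences
  -- vanish and the bound reduces to nonnegativity of the Dirichlet integral.
  refine ⟨fun _ _ => 0, fun R₀ hR f ⟨hY, _, hN⟩ => ?_⟩
  have hfin : IsFiniteMeasure (volume.restrict (ball (0 : ℂ) R₀)) :=
    ⟨by rw [Measure.restrict_apply_univ]; exact measure_ball_lt_top⟩
  obtain ⟨φ, hφ, hae⟩ := hN.exists_differentiableOn_ae_eq_hopf hY isOpen_ball hfin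
  refine ⟨fun _ => φ, fun e => ?_, fun e e' => ⟨fun z _ => by simp, ?_⟩⟩
  · have hF := hY.memW12_xi0 isOpen_ball hfin e
    obtain ⟨h, hharm, hC1, hd⟩ := QVal.exists_harmonic_of_differentiableOn hφ
    refine ⟨⟨hF, hφ, hae e⟩, h, hharm, fun z hz => ?_, QVal.memW12Loc_prod isOpen_ball hF hC1,
      QVal.weaklyConformal_prod isOpen_ball hF (hae e) hC1 hd⟩
    obtain ⟨d1, d2⟩ := hd z hz
    rw [QVal.dz, QVal.dzbar, d1, d2]
    constructor
    · linear_combination (-(1 / 2)) * ((-1 / 4) * φ z - 1) * Complex.I_mul_I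
    · linear_combination (1 / 2) * ((-1 / 4) * φ z - 1) * Complex.I_mul_I
  · exact mul_nonneg (by positivity) (QVal.Dir_nonneg _ _)
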